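/- **Setting.** Let $\mathbf N$ be a finitely generated abelian group, $\Sigma\subset\mathbf N_{\mathbb Q}$ a complete rational simplicial fan, and $b_1,\dots,b_m\in\mathbf N$ elements whose images $\bar b_i$ span the (pairwise distinct) rays of $\Sigma$. Let $s_1,\dots,s_l\in\mathbf N$ be box elements of age at most $1$ such that $b_1,\dots,b_m,s_1,\dots,s_l$ generate $\mathbf N$: that is, $\bar s_j=\sum_{i\notin I_j^S}c_{ji}\bar b_i$ with $0\le c_{ji}<1$, $\sum_i c_{ji}\le 1$, where $I_j^S$ is an extended anticone. (A set $I\subset\{1,\dots,m+l\}$ is an extended anticone if it contains $m+1,\dots,m+l$ and $\{\bar b_i:i\notin I\}$ spans a cone of $\Sigma$; put $c_{ji}=0$ for $i\in I_j^S$.) Let $\mathcal X=[\mathcal U^S/G^S]$ be the associated toric Deligne–Mumford stack, $\mathbb L^S=\ker(\beta^S:\mathbb Z^{m+l}\to\mathbf N)$, let $D_i^S\in\mathbb L^{S\vee}=\mathrm{Hom}(\mathbb L^S,\mathbb Z)$ be the $i$-th coordinate function, $\rho^S=\sum_{i=1}^{m+l}D_i^S$, and $v(d)=\sum_i\lceil\langle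 D_i^S,d\rangle\rceil\beta^S(e_i)\in\mathbf N$ for $d\in\mathbb L^S\otimes\mathbb Q$. Assume that $\rho^S$ lies in the closure of the extended Kähler cone $C^S=\bigcap_{I}\sum_{i\in I}\mathbb R_{>0}D_i^S$ ($I$ running over the extended anticones). Let $p_1^S,\dots,p_{r+l}^S$, with $r=m-\operatorname{rank}\mathbf N$, be an integral basis of $\mathbb L^{S\vee}$ in the closure of $C^S$ whose last $l$ members lie in $\sum_{i>m}\mathbb R_{\ge0}D_i^S$, and write $y^d=\prod_{a=1}^{r+l}y_a^{\langle p_a^S,d\rangle}$. For integers $w_1,\dots,w_m\ge0$ and $n\ge1$ let $\mathcal E=\mathcal U^S\times(\mathbb C^2\setminus0)/(G^S\times\mathbb C^\times)$, where $t\in\mathbb C^\times$ acts by $z_i\mapsto t^{-w_i}z_i$ $(i\le m)$, $z_i\mapsto z_i$ $(m<i\le m+l)$, $(u,v)\mapsto(t^nu,t^nv)$. It is the toric stack with characters $\hat D_i^S=(D_i^S,-w_i)$ $(i\le m)$, $(D_i^S,0)$ $(m<i\le m+l)$, $\hat D^S_{m+l+1}=\hat D^S_{m+l+2}=(0,n)$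 in $\mathbb L^{S\vee}\oplus\mathbb Z$; put $p_0^S=(0,n)$, lift $p_a^S$ to $(p_a^S,0)$, and let $\hat D_i$ and $p_0,\dots,p_r$ be the classes of $\hat D^S_i$ and $p^S_0,\dots,p^S_r$ in $H^2(\mathcal E;\mathbb Q)$. Its $I$-function is $$I_{\mathcal E}=e^{\sum_{a=0}^rp_a\log y_a/z}\sum_{\beta\in\mathbb K_{\mathrm{eff},\mathcal E}}\ \prod_{i=1}^{m+l+2}\frac{\prod_{k\ge\lceil\langle\hat D_i^S,\beta\rangle\rceil}(\hat D_i+(\langle\hat D_i^S,\beta\rangle-k)z)}{\prod_{k\ge0}(\hat D_i+(\langle\hat D_i^S,\beta\rangle-k)z)}\,y^\beta\,\mathbf 1_{v(\beta)}$$ with values in $H^*_{orb}(\mathcal E;\mathbb Q)$, where $y^\beta=\prod_{a=0}^{r+l}y_a^{\langle p_a^S,\beta\rangle}$, $\mathbb K_{\mathrm{eff},\mathcal E}$ is the set of $\beta\in(\mathbb L^S\oplus\mathbb Z)\otimes\mathbb Q$ for which $\{i:\langle\hat D_i^S,\beta\rangle\in\mathbb Z_{\ge0}\}$ is an anticone of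 $\mathcal E$ (it meets $\{m+l+1,m+l+2\}$ and its part in $\{1,\dots,m+l\}$ is an extended anticone), and $v(\beta)$ is the class of $(\lceil\langle\hat D_i^S,\beta\rangle\rceil)_i$ in $\mathbb Z^{m+l+2}/(\mathbb L^S\oplus\mathbb Z)$. The function $g_0$ of $\mathcal E$ is the coefficient of $p_0$ in the expansion $$I_{\mathcal E}=e^{\sum_{a=0}^rp_a\log y_a/z}\Bigl(1+z^{-1}\bigl(\textstyle\sum_{a=0}^rg_a(y)p_a+\tau_{tw}(y)\bigr)+O(z^{-2})\Bigr),$$ where $\tau_{tw}$ has no component in $H^2(\mathcal E)$. Let $g_0^{(j)}$, $1\le j\le m$, be the function $g_0$ for $w_i=\delta_{ij}$, $n=1$, and $g_0^{(m+j)}$, $1\le j\le l$, the function $g_0$ for $w_i=c_{ji}n_j$, $n=n_j$, with $n_j$ the least common denominator of the $c_{ji}$. For $1\le k\le m$ let $\Lambda_k$ be the set of $d\in\mathbb L^S\otimes\mathbb Q$ with $\langle D_i^S,d\rangle\in\mathbb Z$ for all $1\le i\le m+l$, $v(d)=0$, $\langle\rho^S,d\rangle=0$, $\langle D_k^S,d\rangle<0$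 and $\langle D_i^S,d\rangle\ge0$ for all $i\ne k$. (The condition $v(d)=0$, i.e. $d\in\mathbb L^S$, follows from the integrality condition if $\mathbf N$ is torsion-free, and may then be omitted.) **Claim.** The expansion above exists, the functions $g_0^{(j)}$ and $g_0^{(m+j)}$ are uniquely determined by it, they do not depend on $y_0$, and $$g_0^{(j)}(y_1,\dots,y_{r+l})=\sum_{d\in\Lambda_j}\frac{(-1)^{-\langle D_j^S,d\rangle}\bigl(-\langle D_j^S,d\rangle-1\bigr)!}{\prod_{i\ne j}\langle D_i^S,d\rangle!}\,y^d\qquad(1\le j\le m),$$ $$g_0^{(m+j)}(y_1,\dots,y_{r+l})=\sum_{\substack{1\le k\le m\\k\notin I_j^S}}\ \sum_{d\in\Lambda_k}c_{jk}\frac{(-1)^{-\langle D_k^S,d\rangle}\bigl(-\langle D_k^S,d\rangle-1\bigr)!}{\prod_{i\ne k}\langle D_i^S,d\rangle!}\,y^d\qquad(1\le j\le l).$$ -/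

import Mathlib

open scoped TensorProduct Nat

noncomputable section

namespace ToricSeidel

/-! ### Pairings between `𝕃^∨` and `𝕃 ⊗ ℚ` -/

/-- The pairing `⟨ξ, d⟩ ∈ ℚ` of `ξ ∈ Hom(𝕃, ℤ)` with `d ∈ 𝕃 ⊗ ℚ`. -/
def pair {L : Type*} [AddCommGroup L] [Module ℤ L] (ξ : Module.Dual ℤ L) (d : ℚ ⊗[ℤ] L) : ℚ :=
  TensorProduct.rid ℤ ℚ (ξ.lTensor ℚ d)

/-- `x` is an integer. -/
def IsInt (x : ℚ) : Prop := ∃ a : ℤ, x = a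

/-- `x` is a nonnegative integer. -/
def IsNat (x : ℚ) : Prop := ∃ a : ℕ, x = a

/-! ### Toric stacks as quotients

A toric Deligne-Mumford stack is a quotient `[𝒰 / G]` with `G = Hom(𝕃^∨, ℂˣ)` acting on `ℂ^ι`
through characters `D i ∈ 𝕃^∨` and `𝒰 = ℂ^ι ∖ ⋃_{I ∉ 𝒜} ℂ^I`.  The data are the lattice `𝕃`, the
characters and the collection `𝒜` of anticones.  (The lattices `𝕃` used here are free and the
groups `𝕃^∨` have no torsion, so `𝕃^∨ = Hom(𝕃, ℤ)`.) -/
structure ToricData (ι L : Type*) [AddCommGroup L] [Module ℤ L] where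
  /-- the characters `D_i` -/
  D : ι → Module.Dual ℤ L
  /-- the anticones -/
  anticone : Set (Set ι)

namespace ToricData

variable {ι L : Type*} [Fintype ι] [AddCommGroup L] [Module ℤ L] (X : ToricData ι L)

/-- `𝕂 = {d ∈ 𝕃 ⊗ ℚ : {i : ⟨D_i, d⟩ ∈ ℤ} ∈ 𝒜}`. -/
def K : Set (ℚ ⊗[ℤ] L) := {d | {i | IsInt (pair (X.D i) d)} ∈ X.anticone}

/-- `𝕂_eff = {d ∈ 𝕃 ⊗ ℚ : {i : ⟨D_i, d⟩ ∈ ℤ_{≥ 0}} ∈ 𝒜}`. -/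
def Keff : Set (ℚ ⊗[ℤ] L) := {d | {i | IsNat (pair (X.D i) d)} ∈ X.anticone}

/-- The group `𝐍` in the fan sequence `0 → 𝕃 → ℤ^ι → 𝐍 → 0`. -/
abbrev Nlat : Type _ := (ι → ℤ) ⧸ LinearMap.range (LinearMap.pi X.D)

/-- The vectors `b_i ∈ 𝐍`, images of the standard basis of `ℤ^ι`. -/
def b (i : ι) : X.Nlat := by
  classical exact Submodule.Quotient.mk (Pi.single i 1)

/-- The reduction function `v(d) = ∑ ⌈⟨D_i, d⟩⌉ b_i`. -/
def v (d : ℚ ⊗[ℤ] L) : X.Nlat := ∑ i, ⌈pair (X.D i) d⌉ • X.b i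

/-- `x̄ = ∑_k c_k b̄_k` in `𝐍 ⊗ ℚ` with `0 ≤ c_k < 1` and `c` supported on a cone of the fan. -/
def IsBoxRep (x : X.Nlat) (c : ι → ℚ) : Prop :=
  (∀ k, 0 ≤ c k ∧ c k < 1) ∧ (∃ I ∈ X.anticone, ∀ k ∈ I, c k = 0) ∧
    (1 : ℚ) ⊗ₜ[ℤ] x = ∑ k, c k ⊗ₜ[ℤ] X.b k

/-- The set of box elements. They index the components of the inertia stack. -/
def Box : Set X.Nlat := {x | ∃ c, X.IsBoxRep x c}

/-- The rays of the smallest cone containing the box element `x`. -/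
def supp (x : X.Nlat) : Set ι := {k | ∃ c, X.IsBoxRep x c ∧ c k ≠ 0}

/-- The relations of `H^*(𝒳_x; ℚ)`, where `𝒳_x` is the component of the inertia stack belonging to
the box element `x`, i.e. the closed toric substack of the cone `supp x`: the monomials
`∏_{i ∈ J} D_i` for which `J ∪ supp x` does not span a cone of the fan, and the linear relations
`∑ a_i D_i` that hold in `𝕃^∨ ⊗ ℚ`. -/
def cohIdeal (x : X.Nlat) : Ideal (MvPolynomial ι ℚ) :=
  Ideal.span
    ({f | ∃ J : Finset ι, ((J : Set ι) ∪ X.supp x)ᶜ ∉ X.anticone ∧ f = ∏ i ∈ J, MvPolynomial.X i} ∪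
     {f | ∃ a : ι → ℚ, (∀ d : L, ∑ i, a i * (X.D i d : ℚ) = 0) ∧
        f = ∑ i, MvPolynomial.C (a i) * MvPolynomial.X i})

/-- `H^*(𝒳_x; ℚ)` in its standard presentation (Stanley-Reisner ring modulo linear relations);
`H^*_orb(𝒳)` is the sum of these over the box elements `x`, and `H^*(𝒳)` is the one for `x = 0`. -/
abbrev Coh (x : X.Nlat) : Type _ := MvPolynomial ι ℚ ⧸ X.cohIdeal x

/-- The class of the divisor `D_i` (pulled back to `𝒳_x`). -/
def divisor (x : X.Nlat) (i : ι) : X.Coh x :=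
  Ideal.Quotient.mk (X.cohIdeal x) (MvPolynomial.X i)

/-- Rational numbers `a_i` with `ξ = ∑ a_i D_i` in `𝕃^∨ ⊗ ℚ`. -/
def coords (ξ : Module.Dual ℤ L) : ι → ℚ :=
  Classical.epsilon fun a => ∀ d : L, (ξ d : ℚ) = ∑ i, a i * (X.D i d : ℚ)

/-- The class in `H^2` of `ξ ∈ 𝕃^∨`: it is `∑ a_i D_i` if `ξ = ∑ a_i D_i` in `𝕃^∨ ⊗ ℚ`. By the
linear relations it does not depend on the choice of the `a_i`. -/
def cls (x : X.Nlat) (ξ : Module.Dual ℤ L) : X.Coh x :=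
  ∑ i, X.coords ξ i • X.divisor x i

end ToricData

/-! ### The `I`-function

Laurent series are taken in the variable `z⁻¹`; `coeff n` is the coefficient of `z^{-n}`. -/

/-- `D + a z` as a Laurent series in `z⁻¹`. -/
def linFactor {R : Type*} [CommRing R] [Algebra ℚ R] (D : R) (a : ℚ) : LaurentSeries R :=
  HahnSeries.single 0 D + HahnSeries.single (-1) (algebraMap ℚ R a)

/-- `∏_{k ≥ ⌈a⌉} (D + (a - k) z) / ∏_{k ≥ 0} (D + (a - k) z)` after cancelling common factors. -/
def hyperFactor {R : Type*} [CommRing R] [Algebra ℚ R] (D : R) (a : ℚ) : LaurentSeries R :=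
  (∏ k ∈ Finset.Ico ⌈a⌉ 0, linFactor D (a - k)) *
    Ring.inverse (∏ k ∈ Finset.Ico 0 ⌈a⌉, linFactor D (a - k))

/-- Formal series in fractional powers of the variables `y_a`, `a ∈ κ`, given by their
coefficients. -/
abbrev FracSeries (κ R : Type*) : Type _ := (κ → ℚ) → R

namespace ToricData

variable {ι L : Type*} [Fintype ι] [AddCommGroup L] [Module ℤ L] (X : ToricData ι L)

/-- The coefficient of `y^e 𝟏_x` in `e^{-∑ p_a log y_a / z} I(y, z)`, where
`I = e^{∑ p_a log y_a / z} ∑_{d ∈ 𝕂_eff} ∏_i (hypergeometric factor) y^d 𝟏_{v(d)}` and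
`y^d = ∏_a y_a^{⟨p_a, d⟩}`. -/
def ICoeff {κ : Type*} (p : κ → Module.Dual ℤ L) (e : κ → ℚ) (x : X.Nlat) :
    LaurentSeries (X.Coh x) :=
  ∑ᶠ d ∈ {d | d ∈ X.Keff ∧ X.v d = x ∧ ∀ a, pair (p a) d = e a},
    ∏ i, hyperFactor (X.divisor x i) (pair (X.D i) d)

open Classical in
/-- The expansion
`e^{-∑ p_a log y_a / z} I = 1 + z⁻¹ (∑_a g_a(y) p_a + τ_tw(y)) + O(z⁻²)`,
where `p_a` runs over those variables whose classes form a basis of `H^2` (selected by `emb`), and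
`τ_tw` has no component in `H^2(𝒳)`: its untwisted part lies in `H^0(𝒳) = ℚ`. -/
def IsMirrorExpansion {κ κ' : Type*} [Fintype κ'] (p : κ → Module.Dual ℤ L) (emb : κ' → κ)
    (g : κ' → FracSeries κ ℚ) (τ : (κ → ℚ) → (x : X.Box) → X.Coh x.1) : Prop :=
  ∀ (e : κ → ℚ) (x : X.Box),
    (∀ n < 0, (X.ICoeff p e x.1).coeff n = 0) ∧
    (X.ICoeff p e x.1).coeff 0 = (if e = 0 ∧ x.1 = 0 then 1 else 0) ∧
    (X.ICoeff p e x.1).coeff 1 =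
      (if x.1 = 0 then ∑ a, g a e • X.cls x.1 (p (emb a)) else 0) + τ e x ∧
    (x.1 = 0 → ∃ t : ℚ, τ e x = algebraMap ℚ _ t)

end ToricData

/-! ### Extended stacky fans -/

/-- The image in `𝐍_ℚ` of an element of `𝐍`. -/
def bar {N : Type*} [AddCommGroup N] (x : N) : ℚ ⊗[ℤ] N := (1 : ℚ) ⊗ₜ[ℤ] x

/-- The cone in `𝐍_ℚ` spanned by the `b̄_i`, `i ∈ J`. -/
def coneOf {N : Type*} [AddCommGroup N] {m : ℕ} (b : Fin m → N) (J : Set (Fin m)) :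
    PointedCone ℚ (ℚ ⊗[ℤ] N) :=
  PointedCone.hull ℚ ((fun i => bar (b i)) '' J)

/-- A stacky fan `(𝐍, Σ, β)` with extension vectors `s_1, …, s_l`; `Σ` is a complete rational
simplicial fan in `𝐍_ℚ` whose rays are spanned by `b̄_1, …, b̄_m`. The fan is given by the sets of
indices of the rays of its cones. -/
structure ExtStackyFan (N : Type*) [AddCommGroup N] (m l : ℕ) where
  b : Fin m → N
  s : Fin l → N
  cones : Set (Set (Fin m))
  empty_mem : ∅ ∈ cones
  ray_mem : ∀ i, {i} ∈ cones
  face_mem : ∀ J ∈ cones, ∀ J' ⊆ J, J' ∈ cones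
  simplicial : ∀ J ∈ cones, LinearIndepOn ℚ (fun i => bar (b i)) J
  inter : ∀ J ∈ cones, ∀ J' ∈ cones, coneOf b J ⊓ coneOf b J' = coneOf b (J ∩ J')
  complete : ∀ x : ℚ ⊗[ℤ] N, ∃ J ∈ cones, x ∈ coneOf b J

namespace ExtStackyFan

variable {N : Type*} [AddCommGroup N] {m l : ℕ} (F : ExtStackyFan N m l)

/-- `β^S(e_i)`. -/
def vec : Fin m ⊕ Fin l → N := Sum.elim F.b F.s

/-- `β^S : ℤ^{m+l} → 𝐍`. -/
def betaS : (Fin m ⊕ Fin l → ℤ) →ₗ[ℤ] N := Fintype.linearCombination ℤ F.vec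

/-- `𝕃^S = ker β^S`. -/
abbrev LS : Type := LinearMap.ker F.betaS

/-- `D_i^S`, `1 ≤ i ≤ m + l`. -/
def DS (i : Fin m ⊕ Fin l) : Module.Dual ℤ F.LS :=
  (LinearMap.proj i) ∘ₗ (LinearMap.ker F.betaS).subtype

/-- The extended anticones `𝒜^S`. -/
def anticoneS : Set (Set (Fin m ⊕ Fin l)) :=
  {I | (∀ k, Sum.inr k ∈ I) ∧ {i | Sum.inl i ∉ I} ∈ F.cones}

/-- The extended Kähler cone `⋂_{I ∈ 𝒜^S} ∑_{i ∈ I} ℝ_{>0} D_i^S`. Elements of `𝕃^{S∨} ⊗ ℝ` are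
regarded as functions on `𝕃^S`. -/
def kahlerCone : Set (F.LS → ℝ) :=
  {f | ∀ I ∈ F.anticoneS, ∃ a : Fin m ⊕ Fin l → ℝ,
    (∀ i ∈ I, 0 < a i) ∧ (∀ i ∉ I, a i = 0) ∧ ∀ d, f d = ∑ i, a i * (F.DS i d : ℝ)}

/-- `ξ ∈ 𝕃^{S∨}` lies in the closure of the extended Kähler cone. -/
def IsNef (ξ : Module.Dual ℤ F.LS) : Prop :=
  (fun d => (ξ d : ℝ)) ∈ closure F.kahlerCone

/-- `ρ^S = ∑ D_i^S`. -/
def rhoS : Module.Dual ℤ F.LS := ∑ i, F.DS i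

/-- `b_1, …, b_m, s_1, …, s_l` generate `𝐍`. -/
def Generates : Prop := Submodule.span ℤ (Set.range F.b ∪ Set.range F.s) = ⊤

/-- `I` is an anticone and `s̄_k = ∑_{i ∉ I} c_i b̄_i` with `0 ≤ c_i < 1`; so `s_k` is a box element
in the cone with anticone `I`. (Here `c_i = 0` for `i ∈ I`.) -/
def IsBoxVector (k : Fin l) (I : Set (Fin m ⊕ Fin l)) (c : Fin m → ℚ) : Prop :=
  I ∈ F.anticoneS ∧ (∀ i, 0 ≤ c i ∧ c i < 1) ∧ (∀ i, Sum.inl i ∈ I → c i = 0) ∧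
    bar (F.s k) = ∑ i, c i • bar (F.b i)

/-- An integral basis `p_1^S, …, p_{r+l}^S` of `𝕃^{S∨}` in the closure of the extended Kähler cone,
the last `l` members of which lie in `∑_{i > m} ℝ_{≥ 0} D_i^S`. -/
def IsNefBasis {r : ℕ} (p : Module.Basis (Fin r ⊕ Fin l) ℤ (Module.Dual ℤ F.LS)) : Prop :=
  (∀ a, F.IsNef (p a)) ∧
    ∀ k : Fin l, ∃ t : Fin l → ℝ, (∀ i, 0 ≤ t i) ∧
      ∀ d, (p (Sum.inr k) d : ℝ) = ∑ i, t i * (F.DS (Sum.inr i) d : ℝ)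

/-! ### Associated bundles

`ℂˣ` acts on `𝒰^S × (ℂ² ∖ 0)` by `(t^{-w_1} z_1, …, t^{-w_m} z_m, z_{m+1}, …, z_{m+l}, t^n u, t^n v)`;
the associated bundle is the quotient by `G^S × ℂˣ`. -/

/-- The associated bundle, with characters in `𝕃^{S∨} ⊕ ℤ`: `(D_i^S, -w_i)` for `i ≤ m`,
`(D_i^S, 0)` for `m < i ≤ m + l`, and `(0, n)` twice. -/
def bundle (w : Fin m → ℤ) (n : ℤ) :
    ToricData ((Fin m ⊕ Fin l) ⊕ Fin 2) (F.LS × ℤ) where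
  D := Sum.elim
    (fun i => (F.DS i).coprod ((-(Sum.elim w 0 : Fin m ⊕ Fin l → ℤ) i) • LinearMap.id))
    (fun _ => (0 : Module.Dual ℤ F.LS).coprod (n • LinearMap.id))
  anticone := {I | {i | Sum.inl i ∈ I} ∈ F.anticoneS ∧ ∃ u, Sum.inr u ∈ I}

/-- `p_0^S = (0, n)` (the index `none`) and `p_a^S = (p_a^S, 0)`. -/
def bundleBasis (n : ℤ) {r : ℕ} (p : Module.Basis (Fin r ⊕ Fin l) ℤ (Module.Dual ℤ F.LS)) :
    Option (Fin r ⊕ Fin l) → Module.Dual ℤ (F.LS × ℤ)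
  | none => (0 : Module.Dual ℤ F.LS).coprod (n • LinearMap.id)
  | some a => (p a).coprod 0

/-- `G(y_0, …, y_{r+l})` is the coefficient `g_0` of `p_0` in the `z⁻¹`-term of the `I`-function of
the bundle with weights `w, n`: there are `g_0 = G, g_1, …, g_r` and `τ_tw` with
`I = e^{∑ p_i log y_i / z} (1 + z⁻¹ (∑_{i=0}^r g_i p_i + τ_tw) + O(z⁻²))`. -/
def IsG0 (w : Fin m → ℤ) (n : ℤ) {r : ℕ}
    (p : Module.Basis (Fin r ⊕ Fin l) ℤ (Module.Dual ℤ F.LS))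
    (G : FracSeries (Option (Fin r ⊕ Fin l)) ℚ) : Prop :=
  ∃ (g : Option (Fin r) → FracSeries (Option (Fin r ⊕ Fin l)) ℚ)
    (τ : (Option (Fin r ⊕ Fin l) → ℚ) → (x : (F.bundle w n).Box) → (F.bundle w n).Coh x.1),
    (F.bundle w n).IsMirrorExpansion (F.bundleBasis n p) (Option.map Sum.inl) g τ ∧ G = g none

/-- `g_0^{(j)}`: the action is `z_j ↦ t⁻¹ z_j`, `(u, v) ↦ (t u, t v)`. -/
def IsDivisorG0 (j : Fin m) {r : ℕ}
    (p : Module.Basis (Fin r ⊕ Fin l) ℤ (Module.Dual ℤ F.LS))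
    (G : FracSeries (Option (Fin r ⊕ Fin l)) ℚ) : Prop :=
  F.IsG0 (Pi.single j 1) 1 p G

/-- The least common denominator of rational numbers `c_1, …, c_m`. -/
def lcd (c : Fin m → ℚ) : ℕ := Finset.univ.lcm fun i => (c i).den

/-- `g_0^{(m+j)}` for a box element `s_j = ∑ c_i b_i`: the action is
`z_i ↦ t^{-c_i n} z_i` for `i ≤ m` and `(u, v) ↦ (t^n u, t^n v)`, where `n` is the least common
denominator of the `c_i` (so that the rational number `c_i n` is an integer). -/
def IsBoxG0 (c : Fin m → ℚ) {r : ℕ}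
    (p : Module.Basis (Fin r ⊕ Fin l) ℤ (Module.Dual ℤ F.LS))
    (G : FracSeries (Option (Fin r ⊕ Fin l)) ℚ) : Prop :=
  F.IsG0 (fun i => (c i * (lcd c : ℚ)).num) (lcd c) p G

/-! ### The explicit series -/

/-- The reduction function `v(d) = ∑_i ⌈⟨D_i^S, d⟩⌉ β^S(e_i) ∈ 𝐍`. -/
def red (d : ℚ ⊗[ℤ] F.LS) : N := ∑ i, ⌈pair (F.DS i) d⌉ • F.vec i

/-- All `d ∈ 𝕃^S ⊗ ℚ` with `⟨D_i^S, d⟩ ∈ ℤ` for all `i`, `⟨ρ^S, d⟩ = 0`, `⟨D_k^S, d⟩ < 0` and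
`⟨D_i^S, d⟩ ≥ 0` for all `i ≠ k`. -/
def corrIndex (k : Fin m) : Set (ℚ ⊗[ℤ] F.LS) :=
  {d | (∀ i, IsInt (pair (F.DS i) d)) ∧ pair F.rhoS d = 0 ∧
    pair (F.DS (Sum.inl k)) d < 0 ∧ ∀ i, i ≠ Sum.inl k → 0 ≤ pair (F.DS i) d}

/-- The members of `corrIndex` in the untwisted sector `v(d) = 0`, i.e. those in `𝕃^S`. If `𝐍` has
no torsion, this is all of `corrIndex`. -/
def corrIndex₀ (k : Fin m) : Set (ℚ ⊗[ℤ] F.LS) := {d ∈ F.corrIndex k | F.red d = 0}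

/-- `(-1)^{-⟨D_k, d⟩} (-⟨D_k, d⟩ - 1)! / ∏_{i ≠ k} ⟨D_i, d⟩!`. -/
def corrCoeff (k : Fin m) (d : ℚ ⊗[ℤ] F.LS) : ℚ :=
  (-1) ^ (-⌊pair (F.DS (Sum.inl k)) d⌋).toNat *
    ((-⌊pair (F.DS (Sum.inl k)) d⌋ - 1).toNat)! /
      ∏ i ∈ Finset.univ.erase (Sum.inl k), ((⌊pair (F.DS i) d⌋.toNat)! : ℚ)

/-- The series `∑_{d ∈ T} corrCoeff k d · y^d` in `y_1, …, y_{r+l}`. -/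
def corrSeries (k : Fin m) (T : Set (ℚ ⊗[ℤ] F.LS)) {r : ℕ}
    (p : Module.Basis (Fin r ⊕ Fin l) ℤ (Module.Dual ℤ F.LS)) :
    FracSeries (Fin r ⊕ Fin l) ℚ :=
  fun e => ∑ᶠ d ∈ {d | d ∈ T ∧ ∀ a, pair (p a) d = e a}, F.corrCoeff k d

end ExtStackyFan

/-- A series in `y_1, …, y_{r+l}`, regarded as a series in `y_0, y_1, …, y_{r+l}` that does not
depend on `y_0`. -/
def constInY0 {κ : Type*} (f : FracSeries κ ℚ) : FracSeries (Option κ) ℚ :=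
  fun e => if e none = 0 then f (fun a => e (some a)) else 0

end ToricSeidel

end

/-! The proof counts powers of `z`. A factor of the `I`-function with `a = ⟨D̂_i, d⟩` begins at
`z^{-⌈a⌉}` with a rational coefficient, except that a negative integer `a` costs one more `z⁻¹` and
brings in the divisor class `D̂_i` (`hasLead_hyperFactor`). So the term of `d` begins at `z^{-(s +
ν)}`, where `s = ∑ ⌈⟨D̂_i, d⟩⌉` and `ν` is the number of negative integral pairings.

For effective `d` one has `s ≥ ⟨ρ^S, d⟩ + n · basePart d ≥ 0`, because `ρ^S` is nef and `∑ w_i ≤ n`;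
the age bound supplies the latter for box elements. If `s = 0`, all pairings are integral, `d` comes
from the fibre and `⟨ρ^S, d⟩ = 0` (`of_sum_ceil_eq_zero`). Hence only `d = 0` reaches `z^0`. In the
untwisted sector `z⁻¹` arises from `s = 1, ν = 0`, a scalar in `H^0` that belongs to `τ_tw`, or from
`s = 0, ν = 1`. In the second case the negative divisor is a ray `k` and `d ∈ Λ_k`, and the term
equals the stated coefficient times `-D̂_k` (`ICoeff_coeff_one`).

Since `D̂_k = -(w_k / n) p_0 + (p_1, …, p_r terms)` (`divisor_ray_eq`), the coefficient of `p_0` is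
`∑_k (w_k / n)` times the series of `Λ_k`. The ratio `w_k / n` is `δ_{jk}` or `c_{jk}`. This
coefficient is unique because degree on a section class defines a ring map to the dual numbers that
sends `p_0` to `ε` and kills `p_1, …, p_r` (`sectionHom`); `isG0_iff` combines the two directions.
-/

namespace ToricSeidel

/-! ### Rational pairings and lattices of functionals -/

section Pairing

variable {L L' : Type*} [AddCommGroup L] [Module ℤ L] [AddCommGroup L'] [Module ℤ L']

theorem pair_tmul (ξ : Module.Dual ℤ L) (q : ℚ) (x : L) :
    pair ξ (q ⊗ₜ[ℤ] x) = q * (ξ x : ℚ) := by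
  simp [pair, mul_comm]

theorem pair_sub (ξ : Module.Dual ℤ L) (d d' : ℚ ⊗[ℤ] L) :
    pair ξ (d - d') = pair ξ d - pair ξ d' := by
  simp [pair]

theorem pair_zero (ξ : Module.Dual ℤ L) : pair ξ 0 = 0 := by
  simp [pair]

/-- Every element of `ℚ ⊗ L` is a lattice element divided by a positive integer. -/
theorem exists_eq_inv_tmul (d : ℚ ⊗[ℤ] L) :
    ∃ (M : ℕ) (x : L), 0 < M ∧ d = (M : ℚ)⁻¹ ⊗ₜ[ℤ] x := by
  -- The `ℤ`-module structure is an arbitrary instance; it is replaced by the canonical one, to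
  -- which it is equal.
  obtain rfl : ‹Module ℤ L› = AddCommGroup.toIntModule L := Subsingleton.elim _ _
  induction d with
  | zero => exact ⟨1, 0, one_pos, by simp⟩
  | tmul q x =>
    refine ⟨q.den, q.num • x, q.den_pos, ?_⟩
    rw [TensorProduct.tmul_smul, TensorProduct.smul_tmul']
    congr 1
    rw [zsmul_eq_mul, ← div_eq_mul_inv, Rat.num_div_den]
  | add d d' h h' =>
    obtain ⟨M, x, hM, rfl⟩ := h
    obtain ⟨M', x', hM', rfl⟩ := h'
    have h0 : (M : ℚ) ≠ 0 := by positivity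
    have h0' : (M' : ℚ) ≠ 0 := by positivity
    refine ⟨M * M', (M' : ℤ) • x + (M : ℤ) • x', by positivity, ?_⟩
    rw [TensorProduct.tmul_add, TensorProduct.tmul_smul, TensorProduct.tmul_smul,
      TensorProduct.smul_tmul', TensorProduct.smul_tmul']
    congr 2 <;> (simp only [zsmul_eq_mul]; push_cast; field_simp)

theorem pair_inv_tmul_eq_zero {ξ : Module.Dual ℤ L} {M : ℕ} {x : L} (hM : 0 < M) :
    pair ξ ((M : ℚ)⁻¹ ⊗ₜ[ℤ] x) = 0 ↔ ξ x = 0 := by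
  rw [pair_tmul]
  have : (M : ℚ) ≠ 0 := by positivity
  simp [this]

theorem eq_zero_of_pair_eq_zero {ι : Type*} {D : ι → Module.Dual ℤ L}
    (hD : ∀ x, (∀ i, D i x = 0) → x = 0) {d : ℚ ⊗[ℤ] L} (h : ∀ i, pair (D i) d = 0) : d = 0 := by
  obtain ⟨M, x, hM, rfl⟩ := exists_eq_inv_tmul d
  rw [hD x fun i => (pair_inv_tmul_eq_zero hM).1 (h i), TensorProduct.tmul_zero]

/-- Applied to the `p_a`, this makes the exponent of `y` determine `d`, so that no two classes
contribute to the same monomial. -/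
theorem eq_of_pair_eq {ι : Type*} {D : ι → Module.Dual ℤ L}
    (hD : ∀ x, (∀ i, D i x = 0) → x = 0) {d d' : ℚ ⊗[ℤ] L}
    (h : ∀ i, pair (D i) d = pair (D i) d') : d = d' :=
  sub_eq_zero.1 <| eq_zero_of_pair_eq_zero hD fun i => by rw [pair_sub, h, sub_self]

theorem pair_lTensor (ξ : Module.Dual ℤ L') (f : L →ₗ[ℤ] L') (d : ℚ ⊗[ℤ] L) :
    pair ξ (f.lTensor ℚ d) = pair (ξ ∘ₗ f) d := by
  simp [pair, LinearMap.lTensor_comp_apply]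

theorem pair_sum_left {ι : Type*} (s : Finset ι) (ξ : ι → Module.Dual ℤ L) (d : ℚ ⊗[ℤ] L) :
    pair (∑ i ∈ s, ξ i) d = ∑ i ∈ s, pair (ξ i) d := by
  obtain ⟨M, x, -, rfl⟩ := exists_eq_inv_tmul d
  simp [pair_tmul, Finset.mul_sum]

/-- A rational functional on a lattice is a rational combination of any family of functionals that
separates the points of the lattice. -/
theorem exists_coords {ι : Type*} [Fintype ι] {D : ι → Module.Dual ℤ L}
    (hD : ∀ x, (∀ i, D i x = 0) → x = 0) (ξ : Module.Dual ℤ L) :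
    ∃ a : ι → ℚ, ∀ x : L, (ξ x : ℚ) = ∑ i, a i * (D i x : ℚ) := by
  classical
  let f (η : Module.Dual ℤ L) : ℚ ⊗[ℤ] L →ₗ[ℚ] ℚ :=
    TensorProduct.AlgebraTensorModule.rid ℤ ℚ ℚ ∘ₗ TensorProduct.AlgebraTensorModule.lTensor ℚ ℚ η
  have hf (η : Module.Dual ℤ L) (q : ℚ) (x : L) : f η (q ⊗ₜ[ℤ] x) = q * (η x : ℚ) := by
    simp [f, mul_comm]
  let T : ℚ ⊗[ℤ] L →ₗ[ℚ] (ι → ℚ) := LinearMap.pi fun i => f (D i)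
  have hT : LinearMap.ker T = ⊥ := by
    refine LinearMap.ker_eq_bot'.2 fun d hd => ?_
    refine eq_zero_of_pair_eq_zero hD fun i => ?_
    have := congrFun hd i
    obtain ⟨M, x, -, rfl⟩ := exists_eq_inv_tmul d
    rw [pair_tmul, ← hf]
    exact this
  -- `T` is an injective map of `ℚ`-vector spaces, so it has a left inverse `g`; the coordinates of
  -- `ξ` are the values of `ξ ∘ g` on the standard basis.
  obtain ⟨g, hg⟩ := T.exists_leftInverse_of_injective hT
  refine ⟨fun i => f ξ (g (Pi.single i 1)), fun x => ?_⟩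
  have h1 : g (T (1 ⊗ₜ x)) = 1 ⊗ₜ x := LinearMap.congr_fun hg _
  have h2 : T (1 ⊗ₜ x) = ∑ i, (D i x : ℚ) • (Pi.single i 1 : ι → ℚ) := by
    ext i
    simp [T, hf, Finset.sum_apply, Pi.single_apply]
  rw [h2, map_sum] at h1
  have h3 := congrArg (f ξ) h1
  rw [hf, one_mul, map_sum] at h3
  rw [← h3]
  exact Finset.sum_congr rfl fun i _ => by rw [map_smul, map_smul, smul_eq_mul, mul_comm]

/-- An element of an abelian group that vanishes after tensoring with `ℚ` is torsion. -/
theorem exists_zsmul_eq_zero_of_one_tmul {A : Type*} [AddCommGroup A] [Module ℤ A] {x : A}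
    (h : (1 : ℚ) ⊗ₜ[ℤ] x = 0) : ∃ M : ℤ, M ≠ 0 ∧ M • x = 0 := by
  obtain rfl : ‹Module ℤ A› = AddCommGroup.toIntModule A := Subsingleton.elim _ _
  have := (IsLocalizedModule.eq_zero_iff (nonZeroDivisors ℤ) (TensorProduct.mk ℤ ℚ A 1)).1 h
  obtain ⟨c, hc⟩ := this
  exact ⟨c, nonZeroDivisors.coe_ne_zero c, hc⟩

end Pairing

/-! ### Leading terms of Laurent series in `z⁻¹` -/

section LeadingTerm

variable {R : Type*} [CommRing R]

/-- `f = c z^{-n} + O(z^{-n-1})`. -/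
def HasLead (f : LaurentSeries R) (n : ℤ) (c : R) : Prop :=
  (∀ k < n, f.coeff k = 0) ∧ f.coeff n = c

/-- In total degree at most `n + n'` the only pair of exponents that can contribute is `(n, n')`.
The coefficient `c * c'` is allowed to vanish. -/
theorem HasLead.mul {f g : LaurentSeries R} {n n' : ℤ} {c c' : R} (hf : HasLead f n c)
    (hg : HasLead g n' c') : HasLead (f * g) (n + n') (c * c') := by
  have key : ∀ k ≤ n + n', ∀ ij ∈ Finset.antidiagonal f.isPWO_support g.isPWO_support k,
      ij = (n, n') := by
    rintro k hk ⟨i, j⟩ hij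
    simp only [Finset.mem_antidiagonal, HahnSeries.mem_support] at hij
    have h1 : n ≤ i := not_lt.1 fun h => hij.1 (hf.1 i h)
    have h2 : n' ≤ j := not_lt.1 fun h => hij.2.1 (hg.1 j h)
    ext <;> dsimp only <;> lia
  constructor
  · intro k hk
    rw [HahnSeries.coeff_mul]
    refine Finset.sum_eq_zero fun ij hij => ?_
    have h1 := key k hk.le ij hij
    rw [Finset.mem_antidiagonal, h1] at hij
    exact absurd hij.2.2 (ne_of_gt hk)
  · rw [HahnSeries.coeff_mul, Finset.sum_subset (s₂ := {(n, n')})]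
    · simp [hf.2, hg.2]
    · exact fun ij hij => by simpa using key _ le_rfl ij hij
    · intro ij hij hij'
      rw [Finset.mem_singleton] at hij
      subst hij
      simp only [Finset.mem_antidiagonal, HahnSeries.mem_support, and_true, not_and_or,
        not_not] at hij'
      rcases hij' with h | h <;> simp [h]

theorem hasLead_one : HasLead (1 : LaurentSeries R) 0 1 :=
  ⟨fun k hk => by rw [HahnSeries.coeff_one, if_neg hk.ne], by simp⟩

theorem HasLead.prod {ι : Type*} (s : Finset ι) {f : ι → LaurentSeries R} {n : ι → ℤ} {c : ι → R}
    (h : ∀ i ∈ s, HasLead (f i) (n i) (c i)) :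
    HasLead (∏ i ∈ s, f i) (∑ i ∈ s, n i) (∏ i ∈ s, c i) := by
  classical
  induction s using Finset.induction_on with
  | empty => simpa using hasLead_one
  | insert i s hi ih =>
    rw [Finset.prod_insert hi, Finset.sum_insert hi, Finset.prod_insert hi]
    exact (h i (Finset.mem_insert_self i s)).mul
      (ih fun j hj => h j (Finset.mem_insert_of_mem hj))

/-- A unit as leading coefficient makes `f` invertible; comparing leading terms in `f * g = 1` then
gives the order and leading coefficient of `g`. -/
theorem HasLead.inverse {f : LaurentSeries R} {n : ℤ} {u v : R} (hf : HasLead f n u)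
    (huv : v * u = 1) : HasLead (Ring.inverse f) (-n) v := by
  rcases subsingleton_or_nontrivial R with hR | hR
  · exact ⟨fun _ _ => Subsingleton.elim _ _, Subsingleton.elim _ _⟩
  have hu : u ≠ 0 := by rintro rfl; simp at huv
  have hunit : IsUnit u := .of_mul_eq_one_right v huv
  have horder : f ≠ 0 ∧ f.order = n := by
    have hf0 : f ≠ 0 := by
      rintro rfl
      exact hu (by rw [← hf.2]; simp)
    refine ⟨hf0, le_antisymm (HahnSeries.order_le_of_coeff_ne_zero (by rwa [hf.2])) ?_⟩
    exact not_lt.1 fun h => HahnSeries.leadingCoeff_ne_zero.2 hf0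
      (HahnSeries.leadingCoeff_eq.trans (hf.1 _ h))
  have hfu : IsUnit f := by
    refine HahnSeries.isUnit_of_isUnit_leadingCoeff_AddUnitOrder ?_ ?_
    · rwa [HahnSeries.leadingCoeff_eq, horder.2, hf.2]
    · exact AddGroup.isAddUnit _
  set g := Ring.inverse f with hg
  have hfg : f * g = 1 := Ring.mul_inverse_cancel f hfu
  have hg0 : g ≠ 0 := by
    intro h
    rw [h, mul_zero] at hfg
    exact zero_ne_one hfg
  have hglead : HasLead g g.order (g.coeff g.order) :=
    ⟨fun k hk => HahnSeries.coeff_eq_zero_of_lt_order hk, rfl⟩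
  have hprod := hf.mul hglead
  rw [hfg] at hprod
  -- The ring may have zero divisors, but `u` is a unit, so the leading coefficients cannot cancel
  -- and the order of `f * g` is exactly `n + g.order`.
  have hne : u * g.coeff g.order ≠ 0 := fun h =>
    HahnSeries.leadingCoeff_ne_zero.2 hg0
      (HahnSeries.leadingCoeff_eq.trans (hunit.mul_right_eq_zero.1 h))
  have h0 : n + g.order = 0 := by
    by_contra h
    exact hne (by rw [← hprod.2, HahnSeries.coeff_one, if_neg h])
  have h1 := hprod.2
  rw [h0, hasLead_one.2] at h1
  have h2 : g.order = -n := by lia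
  refine ⟨fun k hk => hglead.1 k (h2 ▸ hk), ?_⟩
  rw [← h2]
  calc g.coeff g.order = v * u * g.coeff g.order := by rw [huv, one_mul]
    _ = v * (u * g.coeff g.order) := by ring
    _ = v := by rw [← h1, mul_one]

end LeadingTerm

end ToricSeidel

namespace ToricSeidel

/-! ### Leading terms of the hypergeometric factors -/

section HyperFactor

variable {R : Type*} [CommRing R] [Algebra ℚ R]

theorem hasLead_linFactor_zero (D : R) : HasLead (linFactor D 0) 0 D := by
  constructor
  · intro k hk
    simp [linFactor, HahnSeries.coeff_single_of_ne hk.ne]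
  · simp [linFactor]

theorem hasLead_linFactor (D : R) (a : ℚ) : HasLead (linFactor D a) (-1) (algebraMap ℚ R a) := by
  constructor
  · intro k hk
    simp [linFactor, HahnSeries.coeff_single_of_ne hk.ne,
      HahnSeries.coeff_single_of_ne (show k ≠ 0 by lia)]
  · simp [linFactor]

/-- `a` is a negative integer. -/
def IsNegInt (a : ℚ) : Prop := IsInt a ∧ a < 0

open Classical in
/-- The rational factor of the leading coefficient of `hyperFactor D a`. -/
noncomputable def leadScalar (a : ℚ) : ℚ :=
  (∏ k ∈ (Finset.Ico ⌈a⌉ 0).filter (fun k : ℤ => a ≠ k), (a - k)) *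
    (∏ k ∈ Finset.Ico 0 ⌈a⌉, (a - k))⁻¹

/-- For `0 ≤ k < ⌈a⌉` the number `a - k` is positive, so every factor has an invertible leading
coefficient. -/
theorem hasLead_hyperFactor_denom (D : R) (a : ℚ) :
    HasLead (Ring.inverse (∏ k ∈ Finset.Ico 0 ⌈a⌉, linFactor D (a - k)))
      (max ⌈a⌉ 0) (algebraMap ℚ R (∏ k ∈ Finset.Ico 0 ⌈a⌉, (a - k))⁻¹) := by
  have h := HasLead.prod (Finset.Ico 0 ⌈a⌉) fun k _ => hasLead_linFactor D (a - k)
  rw [← map_prod] at h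
  have hne : ∏ k ∈ Finset.Ico 0 ⌈a⌉, (a - k) ≠ 0 := by
    refine Finset.prod_ne_zero_iff.2 fun k hk => ?_
    have := Int.lt_ceil.1 (Finset.mem_Ico.1 hk).2
    exact (sub_pos.2 this).ne'
  have h2 := h.inverse (v := algebraMap ℚ R (∏ k ∈ Finset.Ico 0 ⌈a⌉, (a - k))⁻¹)
    (by rw [← map_mul, inv_mul_cancel₀ hne, map_one])
  convert h2 using 1
  simp

-- Each linear factor contributes one power of `z`, except the factor `k = a` of the numerator. It
-- is present only for a negative integer `a`, and it is the class `D` itself.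
open Classical in
theorem hasLead_hyperFactor (D : R) (a : ℚ) :
    HasLead (hyperFactor D a) (⌈a⌉ + if IsNegInt a then 1 else 0)
      (algebraMap ℚ R (leadScalar a) * if IsNegInt a then D else 1) := by
  have hden := hasLead_hyperFactor_denom D a
  have hnum : HasLead (∏ k ∈ Finset.Ico ⌈a⌉ 0, linFactor D (a - k))
      (min ⌈a⌉ 0 + if IsNegInt a then 1 else 0)
      (algebraMap ℚ R (∏ k ∈ (Finset.Ico ⌈a⌉ 0).filter (fun k : ℤ => a ≠ k), (a - k)) *
        if IsNegInt a then D else 1) := by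
    rw [map_prod]
    by_cases ha : IsNegInt a
    · rw [if_pos ha, if_pos ha]
      obtain ⟨⟨b, rfl⟩, hb⟩ := ha
      have hb' : b < 0 := by exact_mod_cast hb
      have hf : (Finset.Ico ⌈(b : ℚ)⌉ 0).filter (fun k : ℤ => (b : ℚ) ≠ k) =
          Finset.Ico (b + 1) 0 := by
        ext k
        simp only [Finset.mem_filter, Finset.mem_Ico, Int.ceil_intCast, ne_eq, Int.cast_inj]
        lia
      -- The factor `k = b` is split off; it is `D + 0 · z`.
      rw [hf, Int.ceil_intCast, ← Finset.insert_Ico_add_one_left_eq_Ico hb',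
        Finset.prod_insert (by simp), sub_self]
      have h := (hasLead_linFactor_zero D).mul
        (HasLead.prod (Finset.Ico (b + 1) 0) fun k _ => hasLead_linFactor D (b - k))
      convert h using 1
      · simp
        lia
      · rw [mul_comm]
    · have hf : (Finset.Ico ⌈a⌉ 0).filter (fun k : ℤ => a ≠ k) = Finset.Ico ⌈a⌉ 0 := by
        refine Finset.filter_true_of_mem fun k hk hak => ha ⟨⟨k, hak⟩, ?_⟩
        rw [hak]
        exact_mod_cast (Finset.mem_Ico.1 hk).2
      rw [if_neg ha, if_neg ha, hf, mul_one]
      convert HasLead.prod (Finset.Ico ⌈a⌉ 0) fun k _ => hasLead_linFactor D (a - k) using 1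
      simp
      lia
  rw [hyperFactor]
  convert hnum.mul hden using 1
  · rw [add_right_comm, min_add_max, add_zero]
  · rw [leadScalar, map_mul]
    ring

theorem hyperFactor_zero (D : R) : hyperFactor D 0 = 1 := by
  simp [hyperFactor]

theorem leadScalar_natCast (n : ℕ) : leadScalar n = ((n ! : ℕ) : ℚ)⁻¹ := by
  rw [leadScalar, Finset.Ico_eq_empty (by simp), Finset.filter_empty, Finset.prod_empty, one_mul,
    ← Finset.prod_range_add_one_eq_factorial]
  congr 1
  push_cast
  refine Finset.prod_nbij' (fun k : ℤ => (n - 1 - k).toNat) (fun k : ℕ => (n - 1 - k : ℤ))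
    ?_ ?_ ?_ ?_ ?_
  · intro k hk
    simp only [Int.ceil_natCast, Finset.mem_Ico, Finset.mem_range] at hk ⊢
    lia
  · intro k hk
    simp only [Int.ceil_natCast, Finset.mem_Ico, Finset.mem_range] at hk ⊢
    lia
  · intro k hk
    simp only [Int.ceil_natCast, Finset.mem_Ico] at hk
    lia
  · intro k hk
    simp only [Finset.mem_range] at hk
    lia
  · intro k hk
    simp only [Int.ceil_natCast, Finset.mem_Ico] at hk
    have : ((((n : ℤ) - 1 - k).toNat : ℤ) : ℚ) = n - 1 - k := by
      rw [Int.toNat_of_nonneg (by lia)]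
      push_cast
      ring
    rw [Int.cast_natCast] at this
    rw [this]
    ring

theorem leadScalar_neg_natCast_add_one (n : ℕ) :
    leadScalar (-(n + 1 : ℕ)) = (-1) ^ n * ((n ! : ℕ) : ℚ) := by
  have hc : ⌈(-(n + 1 : ℕ) : ℚ)⌉ = -(n + 1 : ℤ) := by
    rw [← Int.cast_natCast, ← Int.cast_neg, Int.ceil_intCast]
    push_cast
    ring
  rw [leadScalar, hc, Finset.Ico_eq_empty (a := 0) (by lia), Finset.prod_empty, inv_one, mul_one,
    ← Finset.prod_range_add_one_eq_factorial]
  have : (-1 : ℚ) ^ n = ∏ _k ∈ Finset.range n, (-1) := by simp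
  rw [this]
  push_cast
  rw [← Finset.prod_mul_distrib]
  have hmem (k : ℤ) : k ∈ (Finset.Ico (-(n + 1 : ℤ)) 0).filter
      (fun k : ℤ => (-(n + 1) : ℚ) ≠ k) ↔ -(n : ℤ) ≤ k ∧ k < 0 := by
    have : ((-(n + 1) : ℚ) = k) ↔ -(n + 1 : ℤ) = k := by
      rw [← Int.cast_inj (α := ℚ)]
      push_cast
      rfl
    rw [Finset.mem_filter, Finset.mem_Ico, ne_eq, this]
    lia
  -- With `k' = n + k` the factor `-(n + 1) - k` becomes `-(k' + 1)`; the excluded index is `k = -(n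
  -- + 1)`.
  refine Finset.prod_nbij' (fun k : ℤ => (n + k).toNat) (fun k : ℕ => (k - n : ℤ))
    ?_ ?_ ?_ ?_ ?_
  · intro k hk
    rw [hmem] at hk
    rw [Finset.mem_range]
    lia
  · intro k hk
    rw [hmem]
    rw [Finset.mem_range] at hk
    lia
  · intro k hk
    rw [hmem] at hk
    lia
  · intro k hk
    rw [Finset.mem_range] at hk
    lia
  · intro k hk
    rw [hmem] at hk
    have : ((((n : ℤ) + k).toNat : ℤ) : ℚ) = n + k := by
      rw [Int.toNat_of_nonneg (by lia)]
      push_cast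
      ring
    rw [Int.cast_natCast] at this
    rw [this]
    ring

-- This is the power count on which everything rests: the sum of the ceilings, plus one for each
-- divisor of negative integral degree.
open Classical in
theorem hasLead_prod_hyperFactor {ι : Type*} [Fintype ι] (D : ι → R) (a : ι → ℚ) :
    HasLead (∏ i, hyperFactor (D i) (a i))
      (∑ i, ⌈a i⌉ + (Finset.univ.filter fun i => IsNegInt (a i)).card)
      (algebraMap ℚ R (∏ i, leadScalar (a i)) *
        ∏ i ∈ Finset.univ.filter (fun i => IsNegInt (a i)), D i) := by
  convert HasLead.prod Finset.univ fun i _ => hasLead_hyperFactor (D i) (a i) using 1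
  · rw [Finset.sum_add_distrib, Finset.sum_boole]
  · rw [Finset.prod_mul_distrib, map_prod, Finset.prod_filter]

end HyperFactor

end ToricSeidel

/-! ### Integral relations and divisor classes of toric stacks -/

namespace ToricSeidel

/-- A rational relation `∑ c_k f(e_k) = 0` after tensoring with `ℚ` is, up to a multiple, an
integral relation. -/
theorem exists_map_eq_zero_of_sum_tmul_eq_zero {ι A : Type*} [Fintype ι] [DecidableEq ι]
    [AddCommGroup A] [Module ℤ A] (f : (ι → ℤ) →ₗ[ℤ] A) {c : ι → ℚ}
    (h : ∑ k, c k ⊗ₜ[ℤ] f (Pi.single k 1) = 0) :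
    ∃ (M : ℤ) (z : ι → ℤ), M ≠ 0 ∧ f z = 0 ∧ ∀ k, (z k : ℚ) = M * c k := by
  obtain ⟨M, z, hM, hz⟩ := exists_eq_inv_tmul (∑ k, c k ⊗ₜ[ℤ] (Pi.single k 1 : ι → ℤ))
  have hM0 : (M : ℚ) ≠ 0 := by positivity
  have hc (k : ι) : c k = (M : ℚ)⁻¹ * z k := by
    have := congrArg (pair (LinearMap.proj k : (ι → ℤ) →ₗ[ℤ] ℤ)) hz
    rw [pair_tmul] at this
    simpa [pair, Pi.single_apply] using this
  have h1 : (1 : ℚ) ⊗ₜ[ℤ] f z = 0 := by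
    have h2 := congrArg (f.lTensor ℚ) hz
    rw [map_sum] at h2
    simp only [LinearMap.lTensor_tmul, h] at h2
    -- Multiplication by `M` on the factor `ℚ` clears the denominator, so that `f z` vanishes after
    -- tensoring and is therefore torsion.
    have h3 := congrArg (LinearMap.rTensor A (LinearMap.mulLeft ℤ (M : ℚ))) h2
    rw [map_zero, LinearMap.rTensor_tmul, LinearMap.mulLeft_apply, mul_inv_cancel₀ hM0] at h3
    exact h3.symm
  obtain ⟨M', hM', h4⟩ := exists_zsmul_eq_zero_of_one_tmul h1
  refine ⟨M' * M, M' • z, mul_ne_zero hM' (by exact_mod_cast hM.ne'), ?_, fun k => ?_⟩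
  · rw [map_zsmul, h4]
  · rw [hc, Pi.smul_apply, smul_eq_mul]
    push_cast
    field_simp

namespace ToricData

theorem b_eq {ι L : Type*} [DecidableEq ι] [AddCommGroup L] [Module ℤ L] (X : ToricData ι L)
    (i : ι) :
    X.b i = Submodule.Quotient.mk (Pi.single i 1) := by
  unfold b
  congr!

variable {ι L : Type*} [Fintype ι] [AddCommGroup L] [Module ℤ L] (X : ToricData ι L)

theorem v_eq (d : ℚ ⊗[ℤ] L) :
    X.v d = Submodule.Quotient.mk (fun i => ⌈pair (X.D i) d⌉) := by
  classical
  have : (fun i => ⌈pair (X.D i) d⌉) = ∑ i, ⌈pair (X.D i) d⌉ • (Pi.single i 1 : ι → ℤ) := by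
    ext j
    simp [Finset.sum_apply, Pi.single_apply]
  rw [this, ← Submodule.mkQ_apply, map_sum]
  refine Finset.sum_congr rfl fun i _ => ?_
  rw [map_zsmul, Submodule.mkQ_apply, b_eq]

theorem v_eq_zero_iff {d : ℚ ⊗[ℤ] L} :
    X.v d = 0 ↔ ∃ x : L, ∀ i, X.D i x = ⌈pair (X.D i) d⌉ := by
  rw [v_eq, Submodule.Quotient.mk_eq_zero, LinearMap.mem_range]
  simp [funext_iff]

theorem v_zero : X.v 0 = 0 := by
  simp [v, pair_zero]

/-- If `i` lies in every anticone, then `{i}` spans no cone and the variable itself is a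
Stanley-Reisner relation. -/
theorem divisor_eq_zero {x : X.Nlat} {i : ι} (h : ∀ I ∈ X.anticone, i ∈ I) :
    X.divisor x i = 0 := by
  rw [divisor, Ideal.Quotient.eq_zero_iff_mem]
  refine Ideal.subset_span (Or.inl ⟨{i}, fun hI => ?_, by simp⟩)
  exact h _ hI (Or.inl (by simp))

/-- Two expansions of `ξ` differ by a linear relation, which lies in the ideal; the choice made in
`coords` is thus harmless. -/
theorem cls_eq {x : X.Nlat} {ξ : Module.Dual ℤ L} {a : ι → ℚ}
    (h : ∀ d : L, (ξ d : ℚ) = ∑ i, a i * (X.D i d : ℚ)) :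
    X.cls x ξ = ∑ i, a i • X.divisor x i := by
  have hc : ∀ d : L, (ξ d : ℚ) = ∑ i, X.coords ξ i * (X.D i d : ℚ) :=
    Classical.epsilon_spec (p := fun a : ι → ℚ => ∀ d : L, (ξ d : ℚ) = ∑ i, a i * (X.D i d : ℚ))
      ⟨a, h⟩
  rw [cls, ← sub_eq_zero, ← Finset.sum_sub_distrib]
  have : ∑ i, (X.coords ξ i • X.divisor x i - a i • X.divisor x i) =
      Ideal.Quotient.mk (X.cohIdeal x)
        (∑ i, MvPolynomial.C (X.coords ξ i - a i) * MvPolynomial.X i) := by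
    rw [map_sum]
    refine Finset.sum_congr rfl fun i _ => ?_
    rw [← sub_smul, MvPolynomial.C_mul', divisor]
    rfl
  rw [this, Ideal.Quotient.eq_zero_iff_mem]
  refine Ideal.subset_span (Or.inr ⟨_, fun d => ?_, rfl⟩)
  simp [sub_mul, ← hc d, ← h d]

theorem cls_D [DecidableEq ι] (x : X.Nlat) (i : ι) : X.cls x (X.D i) = X.divisor x i := by
  rw [X.cls_eq (a := Pi.single i 1)]
  · simp [Pi.single_apply]
  · simp [Pi.single_apply]

theorem cls_combination (hX : ∀ y, (∀ i, X.D i y = 0) → y = 0) {κ : Type*} [Fintype κ]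
    {x : X.Nlat} {ξ : Module.Dual ℤ L} {η : κ → Module.Dual ℤ L} {q : κ → ℚ}
    (h : ∀ d : L, (ξ d : ℚ) = ∑ a, q a * (η a d : ℚ)) :
    X.cls x ξ = ∑ a, q a • X.cls x (η a) := by
  choose α hα using fun a => exists_coords hX (η a)
  rw [X.cls_eq (a := fun i => ∑ a, q a * α a i)]
  · simp_rw [fun a => X.cls_eq (x := x) (hα a), Finset.smul_sum, Finset.sum_smul, mul_smul]
    exact Finset.sum_comm
  · intro d
    rw [h]
    simp_rw [hα, Finset.mul_sum, Finset.sum_mul, mul_assoc]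
    exact Finset.sum_comm

end ToricData

/-! ### Nef classes and relations of the extended stacky fan -/

namespace ExtStackyFan

variable {N : Type*} [AddCommGroup N] {m l : ℕ} (F : ExtStackyFan N m l)

theorem DS_apply (i : Fin m ⊕ Fin l) (x : F.LS) : F.DS i x = x.1 i := rfl

theorem betaS_apply (z : Fin m ⊕ Fin l → ℤ) : F.betaS z = ∑ i, z i • F.vec i := by
  simp [betaS, Fintype.linearCombination_apply]

theorem sum_smul_vec_eq_zero (x : F.LS) : ∑ i, F.DS i x • F.vec i = 0 := by
  have := x.2
  rwa [LinearMap.mem_ker, betaS_apply] at this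

theorem DS_separates (x : F.LS) (h : ∀ i, F.DS i x = 0) : x = 0 :=
  Subtype.ext (funext h)

theorem univ_mem_anticoneS : Set.univ ∈ F.anticoneS :=
  ⟨fun _ => trivial, by simpa using F.empty_mem⟩

theorem anticoneS_mono {I I' : Set (Fin m ⊕ Fin l)} (hI : I ∈ F.anticoneS) (h : I ⊆ I') :
    I' ∈ F.anticoneS :=
  ⟨fun k => h (hI.1 k), F.face_mem _ hI.2 _ fun _ hi hi' => hi (h hi')⟩

variable {F}

/-- The half-space `f x ≥ 0` is closed and contains the extended Kähler cone, hence also its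
closure. -/
theorem IsNef.nonneg {ξ : Module.Dual ℤ F.LS} (hξ : F.IsNef ξ) {I : Set (Fin m ⊕ Fin l)}
    (hI : I ∈ F.anticoneS) {x : F.LS} (hx : ∀ i ∈ I, 0 ≤ F.DS i x) : 0 ≤ ξ x := by
  have hclosed : IsClosed {f : F.LS → ℝ | 0 ≤ f x} :=
    isClosed_le continuous_const (continuous_apply x)
  have hsub : F.kahlerCone ⊆ {f : F.LS → ℝ | 0 ≤ f x} := by
    intro f hf
    obtain ⟨a, ha, ha', hfa⟩ := hf I hI
    change 0 ≤ f x
    rw [hfa]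
    refine Finset.sum_nonneg fun i _ => ?_
    by_cases hi : i ∈ I
    · exact mul_nonneg (ha i hi).le (by exact_mod_cast hx i hi)
    · rw [ha' i hi, zero_mul]
  have h : (0 : ℝ) ≤ (ξ x : ℝ) := closure_minimal hsub hclosed hξ
  exact_mod_cast h

theorem IsNef.pair_nonneg {ξ : Module.Dual ℤ F.LS} (hξ : F.IsNef ξ) {I : Set (Fin m ⊕ Fin l)}
    (hI : I ∈ F.anticoneS) {d : ℚ ⊗[ℤ] F.LS} (hd : ∀ i ∈ I, 0 ≤ pair (F.DS i) d) :
    0 ≤ pair ξ d := by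
  obtain ⟨M, x, hM, rfl⟩ := exists_eq_inv_tmul d
  have hM' : (0 : ℚ) < (M : ℚ)⁻¹ := by positivity
  simp only [pair_tmul, mul_nonneg_iff_of_pos_left hM', Int.cast_nonneg_iff] at hd ⊢
  exact hξ.nonneg hI hd

/-- A relation between the rays of a cone that comes from `𝕃^S` is trivial. -/
theorem eq_zero_of_supported {x : F.LS} {I : Set (Fin m ⊕ Fin l)} (hI : I ∈ F.anticoneS)
    (hx : ∀ i ∈ I, F.DS i x = 0) : x = 0 := by
  have h := congrArg bar (F.sum_smul_vec_eq_zero x)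
  have h1 : ∑ i, (F.DS (Sum.inl i) x : ℚ) • bar (F.b i) = 0 := by
    rw [Fintype.sum_sum_type, Finset.sum_eq_zero (f := fun i => F.DS (Sum.inr i) x • _)
      (fun i _ => by rw [hx _ (hI.1 i), zero_smul]), add_zero] at h
    simp only [bar, TensorProduct.tmul_sum, TensorProduct.tmul_zero] at h
    rw [← h]
    refine Finset.sum_congr rfl fun i _ => ?_
    rw [bar, TensorProduct.tmul_smul, Int.cast_smul_eq_zsmul]
    rfl
  have hli := F.simplicial _ hI.2
  rw [linearIndepOn_iff] at hli
  refine F.DS_separates x fun i => ?_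
  rcases i with i | i
  · by_cases hi : Sum.inl i ∈ I
    · exact hx _ hi
    · have := hli (Finsupp.equivFunOnFinite.symm fun i => (F.DS (Sum.inl i) x : ℚ)) ?_ ?_
      · have := DFunLike.congr_fun this i
        simpa using this
      · rw [Finsupp.mem_supported]
        intro j hj hj'
        simp [hx _ hj'] at hj
      · rw [Finsupp.linearCombination_apply, Finsupp.sum_fintype _ _ (by simp)]
        simpa using h1
  · exact hx _ (hI.1 i)

/-- For a box element `s_k` there is a relation in `𝕃^S` that involves `s_k` and no other extension
vector. -/
theorem IsBoxVector.exists_relation {k : Fin l} {I : Set (Fin m ⊕ Fin l)} {c : Fin m → ℚ}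
    (h : F.IsBoxVector k I c) :
    ∃ (M : ℤ) (x : F.LS), M ≠ 0 ∧ ∀ j, F.DS (Sum.inr j) x = if j = k then M else 0 := by
  classical
  obtain ⟨-, -, -, h⟩ := h
  -- The rational relation is `s̄_k - ∑ c_i b̄_i = 0`; an integral multiple of it lies in `𝕃^S`.
  obtain ⟨M, z, hM, hz, hzc⟩ := exists_map_eq_zero_of_sum_tmul_eq_zero F.betaS
    (c := Sum.elim (fun i => -c i) (fun j => if j = k then 1 else 0)) (by
      have hb (i : Fin m ⊕ Fin l) : F.betaS (Pi.single i 1) = F.vec i := by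
        simp [betaS_apply, Pi.single_apply]
      simp only [hb, Fintype.sum_sum_type, Sum.elim_inl, Sum.elim_inr]
      rw [Finset.sum_eq_single (a := k)]
      · simp only [if_true, vec, Sum.elim_inl, Sum.elim_inr]
        simp only [bar] at h
        rw [h, ← Finset.sum_add_distrib]
        refine Finset.sum_eq_zero fun i _ => ?_
        rw [TensorProduct.smul_tmul', smul_eq_mul, mul_one, ← TensorProduct.add_tmul]
        simp
      · intro j _ hj
        simp [hj]
      · simp)
  refine ⟨M, ⟨z, hz⟩, hM, fun j => ?_⟩
  rw [DS_apply]
  have := hzc (Sum.inr j)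
  split_ifs with hj
  · simp only [Sum.elim_inr, hj, if_true, mul_one] at this
    rw [hj]
    exact_mod_cast this
  · simp only [Sum.elim_inr, hj, if_false, mul_zero] at this
    exact_mod_cast this

end ExtStackyFan

end ToricSeidel

namespace ToricSeidel
namespace ExtStackyFan

variable {N : Type*} [AddCommGroup N] {m l : ℕ} {F : ExtStackyFan N m l}
  {w : Fin m → ℤ} {n : ℤ}

/-! ### Characters of the associated bundle -/

section Characters

theorem bundle_D_ray (i : Fin m) (x : F.LS) (k : ℤ) :
    (F.bundle w n).D (Sum.inl (Sum.inl i)) (x, k) = F.DS (Sum.inl i) x - w i * k := by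
  simp [bundle, sub_eq_add_neg]

theorem bundle_D_ext (j : Fin l) (x : F.LS) (k : ℤ) :
    (F.bundle w n).D (Sum.inl (Sum.inr j)) (x, k) = F.DS (Sum.inr j) x := by
  simp [bundle]

theorem bundle_D_base (u : Fin 2) (x : F.LS) (k : ℤ) :
    (F.bundle w n).D (Sum.inr u) (x, k) = n * k := by
  simp [bundle]

theorem bundle_D_fibre (i : Fin m ⊕ Fin l) (x : F.LS) :
    (F.bundle w n).D (Sum.inl i) (x, 0) = F.DS i x := by
  rcases i with i | i
  · rw [bundle_D_ray, mul_zero, sub_zero]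
  · rw [bundle_D_ext]

theorem bundle_D_separates (hn : 0 < n) (x : F.LS × ℤ) (h : ∀ i, (F.bundle w n).D i x = 0) :
    x = 0 := by
  obtain ⟨x, k⟩ := x
  have hk : k = 0 := by
    have := h (Sum.inr 0)
    rw [bundle_D_base] at this
    exact (mul_eq_zero.1 this).resolve_left hn.ne'
  subst hk
  rw [F.DS_separates x fun i => by rw [← bundle_D_fibre (w := w) (n := n)]; exact h _]
  rfl

theorem basis_separates {r : ℕ} (p : Module.Basis (Fin r ⊕ Fin l) ℤ (Module.Dual ℤ F.LS))
    (x : F.LS) (h : ∀ a, p a x = 0) : x = 0 := by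
  refine F.DS_separates x fun i => ?_
  rw [← p.sum_repr (F.DS i), LinearMap.sum_apply]
  exact Finset.sum_eq_zero fun a _ => by rw [LinearMap.smul_apply, h, smul_zero]

theorem bundleBasis_separates (hn : 0 < n) {r : ℕ}
    (p : Module.Basis (Fin r ⊕ Fin l) ℤ (Module.Dual ℤ F.LS)) (x : F.LS × ℤ)
    (h : ∀ a, F.bundleBasis n p a x = 0) : x = 0 := by
  obtain ⟨x, k⟩ := x
  have hk : k = 0 := by
    have : n * k = 0 := by simpa [bundleBasis] using h none
    exact (mul_eq_zero.1 this).resolve_left hn.ne'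
  rw [hk, basis_separates p x fun a => by simpa [bundleBasis] using h (some a)]
  rfl

/-- The component of `d` in `𝕃^S ⊗ ℚ`. -/
noncomputable def fibrePart (d : ℚ ⊗[ℤ] (F.LS × ℤ)) : ℚ ⊗[ℤ] F.LS :=
  (LinearMap.fst ℤ F.LS ℤ).lTensor ℚ d

/-- The component of `d` in `ℤ ⊗ ℚ = ℚ`. -/
noncomputable def basePart (d : ℚ ⊗[ℤ] (F.LS × ℤ)) : ℚ := pair (LinearMap.snd ℤ F.LS ℤ) d

/-- The inclusion of `𝕃^S ⊗ ℚ`. -/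
noncomputable def ofFibre (d : ℚ ⊗[ℤ] F.LS) : ℚ ⊗[ℤ] (F.LS × ℤ) :=
  (LinearMap.inl ℤ F.LS ℤ).lTensor ℚ d

theorem pair_coprod (ξ : Module.Dual ℤ F.LS) (a : ℤ) (d : ℚ ⊗[ℤ] (F.LS × ℤ)) :
    pair (ξ.coprod (a • LinearMap.id)) d = pair ξ (fibrePart d) + a * basePart d := by
  obtain ⟨M, x, -, rfl⟩ := exists_eq_inv_tmul d
  simp only [fibrePart, basePart, LinearMap.lTensor_tmul, pair_tmul]
  simp
  ring

theorem pair_bundle_ray (i : Fin m) (d : ℚ ⊗[ℤ] (F.LS × ℤ)) :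
    pair ((F.bundle w n).D (Sum.inl (Sum.inl i))) d =
      pair (F.DS (Sum.inl i)) (fibrePart d) - w i * basePart d := by
  have := pair_coprod (F.DS (Sum.inl i)) (-w i) d
  push_cast at this
  rw [neg_mul, ← sub_eq_add_neg] at this
  exact this

theorem pair_bundle_ext (j : Fin l) (d : ℚ ⊗[ℤ] (F.LS × ℤ)) :
    pair ((F.bundle w n).D (Sum.inl (Sum.inr j))) d = pair (F.DS (Sum.inr j)) (fibrePart d) := by
  have := pair_coprod (F.DS (Sum.inr j)) (-0) d
  rw [neg_zero, Int.cast_zero, zero_mul, add_zero] at this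
  exact this

theorem pair_bundle_base (u : Fin 2) (d : ℚ ⊗[ℤ] (F.LS × ℤ)) :
    pair ((F.bundle w n).D (Sum.inr u)) d = n * basePart d := by
  have := pair_coprod (0 : Module.Dual ℤ F.LS) n d
  rw [show pair (0 : Module.Dual ℤ F.LS) (fibrePart d) = 0 by simp [pair], zero_add] at this
  exact this

theorem pair_bundle_inl (i : Fin m ⊕ Fin l) {d : ℚ ⊗[ℤ] (F.LS × ℤ)} (hd : basePart d = 0) :
    pair ((F.bundle w n).D (Sum.inl i)) d = pair (F.DS i) (fibrePart d) := by
  rcases i with i | i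
  · rw [pair_bundle_ray, hd, mul_zero, sub_zero]
  · rw [pair_bundle_ext]

theorem pair_bundleBasis_none {r : ℕ}
    (p : Module.Basis (Fin r ⊕ Fin l) ℤ (Module.Dual ℤ F.LS)) (d : ℚ ⊗[ℤ] (F.LS × ℤ)) :
    pair (F.bundleBasis n p none) d = n * basePart d :=
  pair_bundle_base (w := 0) 0 d

theorem pair_bundleBasis_some {r : ℕ}
    (p : Module.Basis (Fin r ⊕ Fin l) ℤ (Module.Dual ℤ F.LS)) (a : Fin r ⊕ Fin l)
    (d : ℚ ⊗[ℤ] (F.LS × ℤ)) :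
    pair (F.bundleBasis n p (some a)) d = pair (p a) (fibrePart d) := by
  have := pair_coprod (p a) 0 d
  rw [Int.cast_zero, zero_mul, add_zero, zero_smul] at this
  exact this

theorem fibrePart_ofFibre (d : ℚ ⊗[ℤ] F.LS) : fibrePart (ofFibre d) = d := by
  rw [fibrePart, ofFibre, ← LinearMap.lTensor_comp_apply, LinearMap.fst_comp_inl,
    LinearMap.lTensor_id_apply]

theorem basePart_ofFibre (d : ℚ ⊗[ℤ] F.LS) : basePart (ofFibre d) = 0 := by
  rw [basePart, ofFibre, pair_lTensor, LinearMap.snd_comp_inl]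
  simp [pair]

theorem ofFibre_fibrePart (hn : 0 < n) {d : ℚ ⊗[ℤ] (F.LS × ℤ)} (hd : basePart d = 0) :
    ofFibre (fibrePart d) = d := by
  refine eq_of_pair_eq (D := (F.bundle 0 n).D) (bundle_D_separates hn) fun i => ?_
  rcases i with i | u
  · rw [pair_bundle_inl i (basePart_ofFibre _), pair_bundle_inl i hd, fibrePart_ofFibre]
  · rw [pair_bundle_base, pair_bundle_base, basePart_ofFibre, hd]

/-- A lattice vector with the same base coordinates as a fibre class has second component zero, as
`n ≠ 0`. Both sides therefore say that the vector of ceilings lies in `𝕃^S`. -/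
theorem v_ofFibre_eq_zero_iff (hn : 0 < n) (d : ℚ ⊗[ℤ] F.LS) :
    (F.bundle w n).v (ofFibre d) = 0 ↔ F.red d = 0 := by
  have hpair (i : Fin m ⊕ Fin l) : pair ((F.bundle w n).D (Sum.inl i)) (ofFibre d) =
      pair (F.DS i) d := by
    rw [pair_bundle_inl i (basePart_ofFibre _), fibrePart_ofFibre]
  have hbase (u : Fin 2) : pair ((F.bundle w n).D (Sum.inr u)) (ofFibre d) = 0 := by
    rw [pair_bundle_base, basePart_ofFibre, mul_zero]
  rw [ToricData.v_eq_zero_iff]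
  constructor
  · rintro ⟨⟨x, k⟩, h⟩
    have hk : k = 0 := by
      have := h (Sum.inr 0)
      rw [bundle_D_base, hbase, Int.ceil_zero] at this
      exact (mul_eq_zero.1 this).resolve_left hn.ne'
    subst hk
    rw [← F.sum_smul_vec_eq_zero x, red]
    refine Finset.sum_congr rfl fun i _ => ?_
    rw [← hpair i, ← h, bundle_D_fibre]
  · intro h
    refine ⟨(⟨fun i => ⌈pair (F.DS i) d⌉, ?_⟩, 0), ?_⟩
    · rw [LinearMap.mem_ker, betaS_apply]
      exact h
    · rintro (i | u)
      · rw [bundle_D_fibre, DS_apply, hpair]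
      · rw [bundle_D_base, hbase, mul_zero, Int.ceil_zero]

end Characters

/-! ### Degree estimates for effective classes -/

section Effective

theorem bundle_univ_mem_anticone : Set.univ ∈ (F.bundle w n).anticone :=
  ⟨F.univ_mem_anticoneS, 0, trivial⟩

theorem zero_mem_bundle_Keff : 0 ∈ (F.bundle w n).Keff := by
  have : {i | IsNat (pair ((F.bundle w n).D i) 0)} = Set.univ :=
    Set.eq_univ_of_forall fun i => ⟨0, by rw [pair_zero, Nat.cast_zero]⟩
  change _ ∈ (F.bundle w n).anticone
  rw [this]
  exact bundle_univ_mem_anticone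

theorem sum_pair_bundle (d : ℚ ⊗[ℤ] (F.LS × ℤ)) :
    ∑ i, pair ((F.bundle w n).D i) d =
      pair F.rhoS (fibrePart d) + (2 * n - ∑ i, w i : ℤ) * basePart d := by
  rw [rhoS, pair_sum_left, Fintype.sum_sum_type, Fintype.sum_sum_type, Fintype.sum_sum_type]
  simp only [pair_bundle_ray, pair_bundle_ext, pair_bundle_base, Finset.sum_sub_distrib,
    ← Finset.sum_mul, Fin.sum_univ_two]
  push_cast
  ring

variable {d : ℚ ⊗[ℤ] (F.LS × ℤ)}

theorem basePart_nonneg (hn : 0 < n) (hd : d ∈ (F.bundle w n).Keff) : 0 ≤ basePart d := by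
  obtain ⟨-, u, a, ha⟩ := hd
  rw [pair_bundle_base] at ha
  have hn' : (0 : ℚ) < n := by exact_mod_cast hn
  exact (mul_nonneg_iff_of_pos_left hn').1 (ha ▸ a.cast_nonneg)

/-- On the anticone of `d` the fibre degrees are `⟨D̂_i, d⟩ + w_i · basePart d` for rays and `⟨D̂_i,
d⟩` for extension vectors. All are nonnegative, so nefness of `ρ^S` applies. -/
theorem pair_rhoS_nonneg (hw : ∀ i, 0 ≤ w i) (hn : 0 < n) (hrho : F.IsNef F.rhoS)
    (hd : d ∈ (F.bundle w n).Keff) : 0 ≤ pair F.rhoS (fibrePart d) := by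
  have hb := basePart_nonneg hn hd
  refine hrho.pair_nonneg hd.1 fun i hi => ?_
  obtain ⟨a, ha⟩ := hi
  have h0 : (0 : ℚ) ≤ a := a.cast_nonneg
  rcases i with i | i
  · rw [pair_bundle_ray] at ha
    have : (0 : ℚ) ≤ w i * basePart d := mul_nonneg (by exact_mod_cast hw i) hb
    linarith
  · rw [pair_bundle_ext] at ha
    exact ha ▸ h0

/-- The two base divisors contribute `2n`, of which the weights consume at most `n`. -/
theorem sum_pair_bundle_ge (hn : 0 < n) (hwn : ∑ i, w i ≤ n)
    (hd : d ∈ (F.bundle w n).Keff) :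
    pair F.rhoS (fibrePart d) + n * basePart d ≤ ∑ i, pair ((F.bundle w n).D i) d := by
  rw [sum_pair_bundle]
  have h1 : (n : ℚ) ≤ (2 * n - ∑ i, w i : ℤ) := by exact_mod_cast (by lia)
  gcongr
  exact basePart_nonneg hn hd

theorem sum_ceil_nonneg (hw : ∀ i, 0 ≤ w i) (hn : 0 < n) (hwn : ∑ i, w i ≤ n)
    (hrho : F.IsNef F.rhoS) (hd : d ∈ (F.bundle w n).Keff) :
    0 ≤ ∑ i, ⌈pair ((F.bundle w n).D i) d⌉ := by
  have h1 := sum_pair_bundle_ge hn hwn hd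
  have h2 := pair_rhoS_nonneg hw hn hrho hd
  have h3 := basePart_nonneg hn hd
  have hn' : (0 : ℚ) < n := by exact_mod_cast hn
  have h4 : ∑ i, pair ((F.bundle w n).D i) d ≤ ∑ i, (⌈pair ((F.bundle w n).D i) d⌉ : ℚ) :=
    Finset.sum_le_sum fun i _ => Int.le_ceil _
  have h5 : (0 : ℚ) ≤ ∑ i, (⌈pair ((F.bundle w n).D i) d⌉ : ℚ) := by
    have : 0 ≤ n * basePart d := by positivity
    linarith
  exact_mod_cast h5

/-- If the classes `⌈⟨D̂_i, d⟩⌉` add up to zero, then `d` is integral on all divisors, it comes from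
the fibre, and `⟨ρ^S, d⟩ = 0`. -/
theorem of_sum_ceil_eq_zero (hw : ∀ i, 0 ≤ w i) (hn : 0 < n) (hwn : ∑ i, w i ≤ n)
    (hrho : F.IsNef F.rhoS) (hd : d ∈ (F.bundle w n).Keff)
    (h0 : ∑ i, ⌈pair ((F.bundle w n).D i) d⌉ = 0) :
    basePart d = 0 ∧ pair F.rhoS (fibrePart d) = 0 ∧
      ∀ i, pair ((F.bundle w n).D i) d = ⌈pair ((F.bundle w n).D i) d⌉ := by
  have h1 := sum_pair_bundle_ge hn hwn hd
  have h2 := pair_rhoS_nonneg hw hn hrho hd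
  have h3 := basePart_nonneg hn hd
  have hn' : (0 : ℚ) < n := by exact_mod_cast hn
  have h4 : 0 ≤ n * basePart d := by positivity
  have h0' : ∑ i, (⌈pair ((F.bundle w n).D i) d⌉ : ℚ) = 0 := by exact_mod_cast h0
  have hle : ∀ i ∈ Finset.univ, pair ((F.bundle w n).D i) d ≤ ⌈pair ((F.bundle w n).D i) d⌉ :=
    fun i _ => Int.le_ceil _
  have h5 := Finset.sum_le_sum hle
  -- Equality holds throughout `0 ≤ ⟨ρ^S, d⟩ + n · basePart d ≤ ∑ ⟨D̂_i, d⟩ ≤ ∑ ⌈⟨D̂_i, d⟩⌉ = 0`,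
  -- and both summands on the left are nonnegative.
  refine ⟨?_, by linarith, fun i => ?_⟩
  · have : n * basePart d = 0 := by linarith
    exact (mul_eq_zero.1 this).resolve_left hn'.ne'
  · exact (Finset.sum_eq_sum_iff_of_le hle).1 (by linarith) i (Finset.mem_univ i)

theorem eq_zero_of_forall_not_isNegInt (hw : ∀ i, 0 ≤ w i) (hn : 0 < n) (hwn : ∑ i, w i ≤ n)
    (hrho : F.IsNef F.rhoS) (hd : d ∈ (F.bundle w n).Keff)
    (h0 : ∑ i, ⌈pair ((F.bundle w n).D i) d⌉ = 0)
    (hneg : ∀ i, ¬ IsNegInt (pair ((F.bundle w n).D i) d)) : d = 0 := by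
  obtain ⟨-, -, h⟩ := of_sum_ceil_eq_zero hw hn hwn hrho hd h0
  have hpos : ∀ i ∈ Finset.univ, 0 ≤ ⌈pair ((F.bundle w n).D i) d⌉ := fun i _ => by
    by_contra hlt
    refine hneg i ⟨⟨_, h i⟩, ?_⟩
    rw [h i]
    exact_mod_cast not_le.1 hlt
  refine eq_zero_of_pair_eq_zero (D := (F.bundle w n).D) (bundle_D_separates hn) fun i => ?_
  rw [h i, (Finset.sum_eq_zero_iff_of_nonneg hpos).1 h0 i (Finset.mem_univ i), Int.cast_zero]

theorem corrIndex_inj {j k : Fin m} {d : ℚ ⊗[ℤ] F.LS} (hj : d ∈ F.corrIndex j)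
    (hk : d ∈ F.corrIndex k) : j = k := by
  by_contra h
  exact absurd hj.2.2.1 (not_lt.2 (hk.2.2.2 _ fun h' => h (Sum.inl_injective h')))

/-- All pairings except that with the ray `k` are natural numbers, and this one ray spans a cone. -/
theorem ofFibre_mem_Keff {k : Fin m} {d : ℚ ⊗[ℤ] F.LS} (hd : d ∈ F.corrIndex k) :
    ofFibre d ∈ (F.bundle w n).Keff := by
  have hpair (i : Fin m ⊕ Fin l) : pair ((F.bundle w n).D (Sum.inl i)) (ofFibre d) =
      pair (F.DS i) d := by
    rw [pair_bundle_inl i (basePart_ofFibre _), fibrePart_ofFibre]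
  refine ⟨F.anticoneS_mono (I := {i | i ≠ Sum.inl k}) ⟨fun j => by simp, ?_⟩ fun i hi => ?_,
    0, 0, ?_⟩
  · convert F.ray_mem k using 1
    ext i
    simp
  · obtain ⟨a, ha⟩ := hd.1 i
    have h0 := hd.2.2.2 i hi
    rw [ha] at h0
    refine ⟨a.toNat, ?_⟩
    rw [hpair, ha]
    exact_mod_cast (Int.toNat_of_nonneg (by exact_mod_cast h0)).symm
  · rw [pair_bundle_base, basePart_ofFibre, mul_zero, Nat.cast_zero]

end Effective
end ExtStackyFan
end ToricSeidel

namespace ToricSeidel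
namespace ExtStackyFan

variable {N : Type*} [AddCommGroup N] {m l : ℕ} {F : ExtStackyFan N m l}
  {w : Fin m → ℤ} {n : ℤ}

/-! ### Second cohomology of the bundle and the section class -/

section Cohomology

/-- A box representation of `0` gives, after clearing denominators, an element of `𝕃^S ⊕ ℤ` that
vanishes on an anticone. A base index in the anticone kills its second component, and simpliciality
kills the first. -/
theorem bundle_supp_zero (hn : 0 < n) : (F.bundle w n).supp 0 = ∅ := by
  classical
  refine Set.eq_empty_of_forall_notMem ?_
  rintro k ⟨c, ⟨-, ⟨I, ⟨hI, u, hu⟩, hIc⟩, hc⟩, hck⟩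
  refine hck ?_
  rw [TensorProduct.tmul_zero] at hc
  obtain ⟨M, z, hM, hz, hzc⟩ := exists_map_eq_zero_of_sum_tmul_eq_zero
    (LinearMap.range (LinearMap.pi (F.bundle w n).D)).mkQ (c := c) (by
      rw [hc]
      exact Finset.sum_congr rfl fun i _ => by rw [ToricData.b_eq]; rfl)
  rw [Submodule.mkQ_apply, Submodule.Quotient.mk_eq_zero, LinearMap.mem_range] at hz
  obtain ⟨⟨x, a⟩, hx⟩ := hz
  have hM' : (M : ℚ) ≠ 0 := by exact_mod_cast hM
  have hzx (i) : (F.bundle w n).D i (x, a) = z i := congrFun hx i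
  have hz0 {i} (hi : c i = 0) : z i = 0 := by
    have := hzc i
    rw [hi, mul_zero] at this
    exact_mod_cast this
  have ha : a = 0 := by
    have := hzx (Sum.inr u)
    rw [bundle_D_base, hz0 (hIc _ hu)] at this
    exact (mul_eq_zero.1 this).resolve_left hn.ne'
  subst ha
  have hx0 : x = 0 := eq_zero_of_supported hI fun i hi => by
    rw [← bundle_D_fibre (w := w) (n := n), hzx, hz0 (hIc _ hi)]
  have h := hzc k
  rw [← hzx k, hx0, show ((0 : F.LS), (0 : ℤ)) = 0 from rfl, map_zero, Int.cast_zero] at h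
  exact (mul_eq_zero.1 h.symm).resolve_left hM'

theorem divisor_ext_eq_zero (x : (F.bundle w n).Nlat) (j : Fin l) :
    (F.bundle w n).divisor x (Sum.inl (Sum.inr j)) = 0 :=
  (F.bundle w n).divisor_eq_zero fun _ hI => hI.1.1 j

/-- The degrees of the divisors on the section class `(0, 1/n)`. -/
noncomputable def sectionDegree (F : ExtStackyFan N m l) (w : Fin m → ℤ) (n : ℤ)
    (i : (Fin m ⊕ Fin l) ⊕ Fin 2) : ℚ :=
  ((F.bundle w n).D i (0, 1) : ℚ) / n

theorem sectionDegree_ray (i : Fin m) :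
    F.sectionDegree w n (Sum.inl (Sum.inl i)) = -w i / n := by
  simp [sectionDegree, bundle_D_ray]

theorem sectionDegree_ext (j : Fin l) : F.sectionDegree w n (Sum.inl (Sum.inr j)) = 0 := by
  simp [sectionDegree, bundle_D_ext]

/-- Products of two divisors die because `ε² = 0`. A single divisor is a Stanley-Reisner relation
only for an extension vector, whose section degree is zero. Linear relations hold in particular on
`(0, 1)`. -/
theorem aeval_sectionDegree_eq_zero (hn : 0 < n) (f : MvPolynomial ((Fin m ⊕ Fin l) ⊕ Fin 2) ℚ)
    (hf : f ∈ (F.bundle w n).cohIdeal 0) :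
    MvPolynomial.aeval
      (fun i => F.sectionDegree w n i • (DualNumber.eps : DualNumber ℚ)) f = 0 := by
  rw [← RingHom.mem_ker]
  refine (Ideal.span_le.2 ?_ : (F.bundle w n).cohIdeal 0 ≤ _) hf
  rintro _ (⟨J, hJ, rfl⟩ | ⟨a, ha, rfl⟩)
  · rw [SetLike.mem_coe, RingHom.mem_ker, map_prod]
    simp only [MvPolynomial.aeval_X]
    rw [bundle_supp_zero hn, Set.union_empty] at hJ
    by_cases h2 : ∃ i ∈ J, ∃ j ∈ J, i ≠ j
    · obtain ⟨i, hi, j, hj, hij⟩ := h2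
      rw [← Finset.mul_prod_erase J _ hi,
        ← Finset.mul_prod_erase _ _ (Finset.mem_erase.2 ⟨hij.symm, hj⟩), ← mul_assoc,
        smul_mul_smul_comm, DualNumber.eps_mul_eps, smul_zero, zero_mul]
    -- Here `J` has at most one element. Unless that element is an extension index, its complement
    -- is an anticone, contrary to `hJ`.
    · have hext : ∃ j, Sum.inl (Sum.inr j) ∈ J := by
        by_contra! hext
        push Not at h2
        refine hJ ⟨⟨fun k => hext k, ?_⟩, ?_⟩
        · by_cases hray : ∃ i, Sum.inl (Sum.inl i) ∈ J
          · obtain ⟨i, hi⟩ := hray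
            refine F.face_mem _ (F.ray_mem i) _ fun i' hi' => ?_
            have hi'' : Sum.inl (Sum.inl i') ∈ J := by simpa using hi'
            simpa using h2 _ hi'' _ hi
          · refine F.face_mem _ F.empty_mem _ fun i' hi' => hray ⟨i', by simpa using hi'⟩
        · by_cases h0 : Sum.inr 0 ∈ J
          · refine ⟨1, fun h1 => ?_⟩
            simpa using h2 _ h0 _ h1
          · exact ⟨0, h0⟩
      obtain ⟨j, hj⟩ := hext
      exact Finset.prod_eq_zero hj (by rw [sectionDegree_ext, zero_smul])
  · rw [SetLike.mem_coe, RingHom.mem_ker, map_sum]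
    simp only [map_mul, MvPolynomial.aeval_X, MvPolynomial.aeval_C]
    have h := ha (0, 1)
    have h' : ∑ i, a i * F.sectionDegree w n i = 0 := by
      simp only [sectionDegree, ← mul_div_assoc, ← Finset.sum_div, h, zero_div]
    rw [← zero_smul ℚ (DualNumber.eps : DualNumber ℚ), ← h', Finset.sum_smul]
    exact Finset.sum_congr rfl fun i _ => by rw [mul_smul, Algebra.smul_def (a i)]

/-- The ring homomorphism from `H^*` to the dual numbers whose `ε`-part on `H^2` is the degree on
the section class. -/
noncomputable def sectionHom (F : ExtStackyFan N m l) (w : Fin m → ℤ) {n : ℤ} (hn : 0 < n) :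
    (F.bundle w n).Coh 0 →ₐ[ℚ] DualNumber ℚ :=
  Ideal.Quotient.liftₐ _ _ (aeval_sectionDegree_eq_zero (F := F) (w := w) hn)

theorem sectionHom_divisor (hn : 0 < n) (i : (Fin m ⊕ Fin l) ⊕ Fin 2) :
    F.sectionHom w hn ((F.bundle w n).divisor 0 i) =
      F.sectionDegree w n i • (DualNumber.eps : DualNumber ℚ) := by
  rw [sectionHom, ToricData.divisor]
  exact MvPolynomial.aeval_X _ _

theorem sectionHom_cls (hn : 0 < n) (ξ : Module.Dual ℤ (F.LS × ℤ)) :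
    F.sectionHom w hn ((F.bundle w n).cls 0 ξ) =
      ((ξ (0, 1) : ℚ) / n) • (DualNumber.eps : DualNumber ℚ) := by
  obtain ⟨a, ha⟩ := exists_coords (D := (F.bundle w n).D) (bundle_D_separates hn) ξ
  rw [(F.bundle w n).cls_eq ha, map_sum, ha, Finset.sum_div, Finset.sum_smul]
  refine Finset.sum_congr rfl fun i _ => ?_
  rw [map_smul, sectionHom_divisor, smul_smul, sectionDegree, mul_div_assoc]

/-- Such a basis element is a combination of extension divisors, all of which are zero in
cohomology. Its real coefficients must first be shown rational, since `cls` uses rational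
coordinates. -/
theorem cls_bundleBasis_ext (hbox : ∀ k, ∃ I c, F.IsBoxVector k I c) {r : ℕ}
    {p : Module.Basis (Fin r ⊕ Fin l) ℤ (Module.Dual ℤ F.LS)} (hp : F.IsNefBasis p)
    (x : (F.bundle w n).Nlat) (k : Fin l) :
    (F.bundle w n).cls x (F.bundleBasis n p (some (Sum.inr k))) = 0 := by
  obtain ⟨t, -, ht⟩ := hp.2 k
  -- Evaluation on the relation that contains only the extension vector `s_i` isolates `t i`.
  have hrat (i : Fin l) : ∃ q : ℚ, t i = q := by
    obtain ⟨I, c, hI⟩ := hbox i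
    obtain ⟨M, y, hM, hy⟩ := hI.exists_relation
    have hM' : (M : ℝ) ≠ 0 := by exact_mod_cast hM
    refine ⟨p (Sum.inr k) y / M, ?_⟩
    have := ht y
    simp only [hy] at this
    push_cast at this ⊢
    rw [this]
    simp [hM']
  choose q hq using hrat
  rw [(F.bundle w n).cls_eq (a := Sum.elim (Sum.elim 0 q) 0)]
  · rw [Fintype.sum_sum_type, Fintype.sum_sum_type]
    simp [divisor_ext_eq_zero]
  · rintro ⟨y, a⟩
    rw [Fintype.sum_sum_type, Fintype.sum_sum_type]
    simp only [Sum.elim_inl, Sum.elim_inr, Pi.zero_apply, zero_mul, Finset.sum_const_zero,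
      zero_add, add_zero, bundle_D_ext]
    have := ht y
    simp only [hq] at this
    have h2 : F.bundleBasis n p (some (Sum.inr k)) (y, a) = p (Sum.inr k) y := by
      simp [bundleBasis]
    rw [h2]
    exact_mod_cast this

/-- The coefficients of the divisor `D̂_k` in terms of `p_0, …, p_r`. -/
noncomputable def rayCoeff (w : Fin m → ℤ) (n : ℤ) {r : ℕ}
    (p : Module.Basis (Fin r ⊕ Fin l) ℤ (Module.Dual ℤ F.LS)) (k : Fin m) :
    Option (Fin r) → ℚ
  | none => -w k / n
  | some a => p.repr (F.DS (Sum.inl k)) (Sum.inl a)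

/-- The expansion of `D_k^S` in the integral basis is corrected by `-(w_k / n) p_0`; the last `l`
basis classes vanish. -/
theorem divisor_ray_eq (hn : 0 < n) (hbox : ∀ k, ∃ I c, F.IsBoxVector k I c) {r : ℕ}
    {p : Module.Basis (Fin r ⊕ Fin l) ℤ (Module.Dual ℤ F.LS)} (hp : F.IsNefBasis p)
    (x : (F.bundle w n).Nlat) (k : Fin m) :
    (F.bundle w n).divisor x (Sum.inl (Sum.inl k)) =
      ∑ a, rayCoeff w n p k a • (F.bundle w n).cls x (F.bundleBasis n p (a.map Sum.inl)) := by
  classical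
  have hn' : (n : ℚ) ≠ 0 := by exact_mod_cast hn.ne'
  rw [← ToricData.cls_D, (F.bundle w n).cls_combination (bundle_D_separates hn)
    (η := F.bundleBasis n p)
    (q := fun a => a.elim (-w k / n : ℚ) fun a => (p.repr (F.DS (Sum.inl k)) a : ℚ))]
  · rw [Fintype.sum_option, Fintype.sum_sum_type, Fintype.sum_option]
    simp [rayCoeff, cls_bundleBasis_ext hbox hp]
  · rintro ⟨y, a⟩
    rw [bundle_D_ray, Fintype.sum_option]
    have h1 : F.DS (Sum.inl k) y = ∑ a, p.repr (F.DS (Sum.inl k)) a * p a y := by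
      conv_lhs => rw [← p.sum_repr (F.DS (Sum.inl k)), LinearMap.sum_apply]
      rfl
    rw [h1]
    simp only [Option.elim, bundleBasis]
    push_cast
    simp
    field_simp
    ring

end Cohomology
end ExtStackyFan
end ToricSeidel

namespace ToricSeidel
namespace ExtStackyFan

variable {N : Type*} [AddCommGroup N] {m l r : ℕ} {F : ExtStackyFan N m l}
  {w : Fin m → ℤ} {n : ℤ} {p : Module.Basis (Fin r ⊕ Fin l) ℤ (Module.Dual ℤ F.LS)}

/-! ### The coefficients of the `I`-function -/

section Coefficients

/-- The exponent determines `d`, so the finite sum in `ICoeff` has exactly one term. -/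
theorem ICoeff_eq_prod (hn : 0 < n) {d : ℚ ⊗[ℤ] (F.LS × ℤ)} (hd : d ∈ (F.bundle w n).Keff)
    {e : Option (Fin r ⊕ Fin l) → ℚ} (he : ∀ a, pair (F.bundleBasis n p a) d = e a) :
    (F.bundle w n).ICoeff (F.bundleBasis n p) e ((F.bundle w n).v d) =
      ∏ i, hyperFactor ((F.bundle w n).divisor ((F.bundle w n).v d) i)
        (pair ((F.bundle w n).D i) d) := by
  have hset : {d' | d' ∈ (F.bundle w n).Keff ∧ (F.bundle w n).v d' = (F.bundle w n).v d ∧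
      ∀ a, pair (F.bundleBasis n p a) d' = e a} = {d} := by
    ext d'
    constructor
    · rintro ⟨-, -, h⟩
      exact eq_of_pair_eq (D := F.bundleBasis n p) (bundleBasis_separates hn p)
        fun a => (h a).trans (he a).symm
    · rintro rfl
      exact ⟨hd, rfl, he⟩
  rw [ToricData.ICoeff, hset, finsum_mem_singleton]

theorem ICoeff_eq_zero {e : Option (Fin r ⊕ Fin l) → ℚ} {x : (F.bundle w n).Nlat}
    (h : ∀ d ∈ (F.bundle w n).Keff, (F.bundle w n).v d = x →
      ¬ ∀ a, pair (F.bundleBasis n p a) d = e a) :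
    (F.bundle w n).ICoeff (F.bundleBasis n p) e x = 0 := by
  have hset : {d | d ∈ (F.bundle w n).Keff ∧ (F.bundle w n).v d = x ∧
      ∀ a, pair (F.bundleBasis n p a) d = e a} = ∅ :=
    Set.eq_empty_of_forall_notMem fun d hd => h d hd.1 hd.2.1 hd.2.2
  rw [ToricData.ICoeff, hset, finsum_mem_empty]

open Classical in
theorem ICoeff_coeff_of_neg (hw : ∀ i, 0 ≤ w i) (hn : 0 < n) (hwn : ∑ i, w i ≤ n)
    (hrho : F.IsNef F.rhoS) (e : Option (Fin r ⊕ Fin l) → ℚ) (x : (F.bundle w n).Nlat)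
    {k : ℤ} (hk : k < 0) : ((F.bundle w n).ICoeff (F.bundleBasis n p) e x).coeff k = 0 := by
  by_cases h : ∃ d ∈ (F.bundle w n).Keff, (F.bundle w n).v d = x ∧
      ∀ a, pair (F.bundleBasis n p a) d = e a
  · obtain ⟨d, hd, rfl, he⟩ := h
    rw [ICoeff_eq_prod hn hd he]
    refine (hasLead_prod_hyperFactor _ _).1 k ?_
    have := sum_ceil_nonneg hw hn hwn hrho hd
    lia
  · rw [ICoeff_eq_zero fun d hd hv he => h ⟨d, hd, hv, he⟩, HahnSeries.coeff_zero]

open Classical in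
theorem ICoeff_coeff_zero (hw : ∀ i, 0 ≤ w i) (hn : 0 < n) (hwn : ∑ i, w i ≤ n)
    (hrho : F.IsNef F.rhoS) (e : Option (Fin r ⊕ Fin l) → ℚ) (x : (F.bundle w n).Nlat) :
    ((F.bundle w n).ICoeff (F.bundleBasis n p) e x).coeff 0 = if e = 0 ∧ x = 0 then 1 else 0 := by
  by_cases h0 : e = 0 ∧ x = 0
  · obtain ⟨rfl, rfl⟩ := h0
    have h := ICoeff_eq_prod (p := p) (e := 0) hn (zero_mem_bundle_Keff (F := F) (w := w) (n := n))
      fun a => pair_zero _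
    simp only [pair_zero, hyperFactor_zero, Finset.prod_const_one] at h
    rw [ToricData.v_zero] at h
    rw [h, if_pos ⟨rfl, rfl⟩, HahnSeries.coeff_one, if_pos rfl]
  rw [if_neg h0]
  by_cases h : ∃ d ∈ (F.bundle w n).Keff, (F.bundle w n).v d = x ∧
      ∀ a, pair (F.bundleBasis n p a) d = e a
  · obtain ⟨d, hd, rfl, he⟩ := h
    rw [ICoeff_eq_prod hn hd he]
    refine (hasLead_prod_hyperFactor _ _).1 0 ?_
    have hnn := sum_ceil_nonneg hw hn hwn hrho hd
    by_contra hle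
    have hs : ∑ i, ⌈pair ((F.bundle w n).D i) d⌉ = 0 := by lia
    have hc : (Finset.univ.filter fun i => IsNegInt (pair ((F.bundle w n).D i) d)).card = 0 := by
      lia
    rw [Finset.card_eq_zero, Finset.filter_eq_empty_iff] at hc
    have hd0 : d = 0 := eq_zero_of_forall_not_isNegInt hw hn hwn hrho hd hs
      fun i => hc (Finset.mem_univ i)
    subst hd0
    exact h0 ⟨funext fun a => by rw [← he, pair_zero]; rfl, ToricData.v_zero _⟩
  · rw [ICoeff_eq_zero fun d hd hv he => h ⟨d, hd, hv, he⟩, HahnSeries.coeff_zero]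

theorem corrSeries_eq {k : Fin m} {T : Set (ℚ ⊗[ℤ] F.LS)} {d : ℚ ⊗[ℤ] F.LS} (hd : d ∈ T) :
    F.corrSeries k T p (fun a => pair (p a) d) = F.corrCoeff k d := by
  have hset : {d' | d' ∈ T ∧ ∀ a, pair (p a) d' = pair (p a) d} = {d} := by
    ext d'
    constructor
    · rintro ⟨-, h⟩
      exact eq_of_pair_eq (D := p) (basis_separates p) h
    · rintro rfl
      exact ⟨hd, fun _ => rfl⟩
  rw [corrSeries, hset, finsum_mem_singleton]

theorem constInY0_corrSeries_eq {k : Fin m} {T : Set (ℚ ⊗[ℤ] F.LS)}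
    {d : ℚ ⊗[ℤ] F.LS} (hd : d ∈ T) {e : Option (Fin r ⊕ Fin l) → ℚ}
    (he : ∀ a, pair (F.bundleBasis n p a) (ofFibre d) = e a) :
    constInY0 (F.corrSeries k T p) e = F.corrCoeff k d := by
  have h0 : e none = 0 := by rw [← he, pair_bundleBasis_none, basePart_ofFibre, mul_zero]
  rw [constInY0, if_pos h0, ← corrSeries_eq hd (p := p)]
  congr 1
  funext a
  rw [← he, pair_bundleBasis_some, fibrePart_ofFibre]

theorem constInY0_corrSeries_eq_zero {k : Fin m} {T : Set (ℚ ⊗[ℤ] F.LS)}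
    {e : Option (Fin r ⊕ Fin l) → ℚ}
    (h : ∀ d ∈ T, ¬ ∀ a, pair (F.bundleBasis n p a) (ofFibre d) = e a) :
    constInY0 (F.corrSeries k T p) e = 0 := by
  rw [constInY0]
  split_ifs with h0
  · have hset : {d | d ∈ T ∧ ∀ a, pair (p a) d = e (some a)} = ∅ := by
      refine Set.eq_empty_of_forall_notMem ?_
      rintro d ⟨hd, hda⟩
      refine h d hd ?_
      rintro (_ | a)
      · rw [pair_bundleBasis_none, basePart_ofFibre, mul_zero, h0]
      · rw [pair_bundleBasis_some, fibrePart_ofFibre, hda]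
    rw [corrSeries, hset, finsum_mem_empty]
  · rfl

/-- For `⟨D_k, d⟩ = -(b + 1)` the leading scalar is `(-1)^b b!`, while `corrCoeff` carries
`(-1)^{b+1} b!`; this is the source of the minus sign. -/
theorem prod_leadScalar {k : Fin m} {d : ℚ ⊗[ℤ] F.LS} (hd : d ∈ F.corrIndex k) :
    ∏ i, leadScalar (pair ((F.bundle w n).D i) (ofFibre d)) = -F.corrCoeff k d := by
  classical
  rw [Fintype.prod_sum_type]
  have hbase : ∏ u : Fin 2, leadScalar (pair ((F.bundle w n).D (Sum.inr u)) (ofFibre d)) = 1 := by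
    refine Finset.prod_eq_one fun u _ => ?_
    rw [pair_bundle_base, basePart_ofFibre, mul_zero]
    simpa using leadScalar_natCast 0
  simp only [hbase, mul_one, pair_bundle_inl _ (basePart_ofFibre d), fibrePart_ofFibre]
  rw [← Finset.mul_prod_erase _ _ (Finset.mem_univ (Sum.inl k)), corrCoeff]
  have hk : leadScalar (pair (F.DS (Sum.inl k)) d) =
      -((-1) ^ (-⌊pair (F.DS (Sum.inl k)) d⌋).toNat *
        (((-⌊pair (F.DS (Sum.inl k)) d⌋ - 1).toNat)! : ℚ)) := by
    obtain ⟨a, ha⟩ := hd.1 (Sum.inl k)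
    have hneg := hd.2.2.1
    rw [ha] at hneg ⊢
    have hneg' : a < 0 := by exact_mod_cast hneg
    obtain ⟨b, rfl⟩ : ∃ b : ℕ, a = -(b + 1 : ℕ) := ⟨(-a - 1).toNat, by lia⟩
    have h1 : (-⌊((-(b + 1 : ℕ) : ℤ) : ℚ)⌋).toNat = b + 1 := by
      rw [Int.floor_intCast]
      lia
    have h2 : (-⌊((-(b + 1 : ℕ) : ℤ) : ℚ)⌋ - 1).toNat = b := by
      rw [Int.floor_intCast]
      lia
    rw [h1, h2, pow_succ]
    have := leadScalar_neg_natCast_add_one b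
    push_cast at this ⊢
    rw [this]
    ring
  have hi : ∀ i ∈ Finset.univ.erase (Sum.inl k), leadScalar (pair (F.DS i) d) =
      ((⌊pair (F.DS i) d⌋.toNat)! : ℚ)⁻¹ := by
    intro i hi
    obtain ⟨a, ha⟩ := hd.1 i
    have hpos := hd.2.2.2 i (Finset.ne_of_mem_erase hi)
    rw [ha] at hpos ⊢
    have hpos' : 0 ≤ a := by exact_mod_cast hpos
    obtain ⟨b, rfl⟩ := Int.eq_ofNat_of_zero_le hpos'
    rw [Int.floor_intCast, Int.toNat_natCast, Int.cast_natCast, leadScalar_natCast]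
  rw [hk, Finset.prod_congr rfl hi, Finset.prod_inv_distrib]
  ring

open Classical in
theorem filter_isNegInt_ofFibre {k : Fin m} {d : ℚ ⊗[ℤ] F.LS} (hd : d ∈ F.corrIndex k) :
    (Finset.univ.filter fun i => IsNegInt (pair ((F.bundle w n).D i) (ofFibre d))) =
      {Sum.inl (Sum.inl k)} := by
  ext i
  rw [Finset.mem_filter, Finset.mem_singleton, and_iff_right (Finset.mem_univ i)]
  rcases i with i | u
  · rw [pair_bundle_inl i (basePart_ofFibre d), fibrePart_ofFibre, Sum.inl_injective.eq_iff]
    constructor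
    · intro h
      by_contra hi
      exact absurd h.2 (not_lt.2 (hd.2.2.2 i hi))
    · rintro rfl
      exact ⟨hd.1 _, hd.2.2.1⟩
  · rw [pair_bundle_base, basePart_ofFibre, mul_zero]
    simp [IsNegInt]

theorem sum_ceil_ofFibre {k : Fin m} {d : ℚ ⊗[ℤ] F.LS} (hd : d ∈ F.corrIndex k) :
    ∑ i, ⌈pair ((F.bundle w n).D i) (ofFibre d)⌉ = 0 := by
  rw [Fintype.sum_sum_type]
  simp only [pair_bundle_inl _ (basePart_ofFibre d), fibrePart_ofFibre, pair_bundle_base,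
    basePart_ofFibre, mul_zero, Int.ceil_zero, Finset.sum_const_zero, add_zero]
  have hrho := hd.2.1
  rw [rhoS, pair_sum_left] at hrho
  have h : ∀ i, (⌈pair (F.DS i) d⌉ : ℚ) = pair (F.DS i) d := fun i => by
    obtain ⟨a, ha⟩ := hd.1 i
    rw [ha, Int.ceil_intCast]
  have : (∑ i, (⌈pair (F.DS i) d⌉ : ℚ)) = 0 := by rw [Finset.sum_congr rfl fun i _ => h i, hrho]
  exact_mod_cast this

/-- An effective class with vanishing total degree and exactly one negative divisor. -/
theorem exists_mem_corrIndex (hw : ∀ i, 0 ≤ w i) (hn : 0 < n) (hwn : ∑ i, w i ≤ n)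
    (hrho : F.IsNef F.rhoS) {d : ℚ ⊗[ℤ] (F.LS × ℤ)} (hd : d ∈ (F.bundle w n).Keff)
    (h0 : ∑ i, ⌈pair ((F.bundle w n).D i) d⌉ = 0) {j : (Fin m ⊕ Fin l) ⊕ Fin 2}
    (hj : ∀ i, IsNegInt (pair ((F.bundle w n).D i) d) ↔ i = j) :
    ∃ k, ∃ d' ∈ F.corrIndex k, ofFibre d' = d := by
  obtain ⟨hb, hr, hint⟩ := of_sum_ceil_eq_zero hw hn hwn hrho hd h0
  have hneg := ((hj j).2 rfl).2
  rcases j with (k | j) | u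
  · refine ⟨k, fibrePart d, ⟨fun i => ⟨_, (pair_bundle_inl i hb).symm.trans (hint _)⟩, hr, ?_,
      fun i hi => ?_⟩, ofFibre_fibrePart hn hb⟩
    · rwa [← pair_bundle_inl (w := w) (n := n) _ hb]
    · rw [← pair_bundle_inl (w := w) (n := n) _ hb]
      by_contra hlt
      exact hi (Sum.inl_injective ((hj _).1 ⟨⟨_, hint _⟩, not_le.1 hlt⟩))
  · obtain ⟨a, ha⟩ := hd.1.1 j
    rw [ha] at hneg
    exact absurd hneg (not_lt.2 a.cast_nonneg)
  · rw [pair_bundle_base, hb, mul_zero] at hneg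
    exact absurd hneg (lt_irrefl _)

-- Order one requires ceiling sum `1` with no negative divisor, or ceiling sum `0` with exactly one.
-- The former gives the scalar `t`, the latter an element of some `Λ_k`.
open Classical in
theorem ICoeff_coeff_one (hw : ∀ i, 0 ≤ w i) (hn : 0 < n) (hwn : ∑ i, w i ≤ n)
    (hrho : F.IsNef F.rhoS) (e : Option (Fin r ⊕ Fin l) → ℚ) :
    ∃ t : ℚ, ((F.bundle w n).ICoeff (F.bundleBasis n p) e 0).coeff 1 = algebraMap ℚ _ t -
      ∑ k, constInY0 (F.corrSeries k (F.corrIndex₀ k) p) e •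
        (F.bundle w n).divisor 0 (Sum.inl (Sum.inl k)) := by
  by_cases hcorr : ∃ k, ∃ d ∈ F.corrIndex₀ k, ∀ a, pair (F.bundleBasis n p a) (ofFibre d) = e a
  · obtain ⟨k, d, hd, he⟩ := hcorr
    refine ⟨0, ?_⟩
    have hv : (F.bundle w n).v (ofFibre d) = 0 := (v_ofFibre_eq_zero_iff hn d).2 hd.2
    have hI := ICoeff_eq_prod hn (ofFibre_mem_Keff (w := w) (n := n) hd.1) he
    rw [hv] at hI
    have hlead := hasLead_prod_hyperFactor (fun i => (F.bundle w n).divisor 0 i)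
      fun i => pair ((F.bundle w n).D i) (ofFibre d)
    rw [filter_isNegInt_ofFibre hd.1, sum_ceil_ofFibre hd.1, prod_leadScalar hd.1,
      Finset.card_singleton, Finset.prod_singleton, Nat.cast_one, zero_add, ← hI] at hlead
    rw [hlead.2, Finset.sum_eq_single (a := k), constInY0_corrSeries_eq hd he, map_zero,
      zero_sub, ← Algebra.smul_def, neg_smul]
    · intro j _ hjk
      rw [constInY0_corrSeries_eq_zero (n := n), zero_smul]
      intro d' hd' he'
      -- Equal exponents force equal classes, and a class has only one negative ray; so the other
      -- series have no term at `e`.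
      have : ofFibre d' = ofFibre d :=
        eq_of_pair_eq (D := F.bundleBasis n p) (bundleBasis_separates hn p)
          fun a => (he' a).trans (he a).symm
      have h := congrArg fibrePart this
      rw [fibrePart_ofFibre, fibrePart_ofFibre] at h
      subst h
      exact hjk (corrIndex_inj hd'.1 hd.1)
    · simp
  · have hzero (k : Fin m) : constInY0 (F.corrSeries k (F.corrIndex₀ k) p) e = 0 :=
      constInY0_corrSeries_eq_zero fun d hd he => hcorr ⟨k, d, hd, he⟩
    simp only [hzero, zero_smul, Finset.sum_const_zero, sub_zero]
    by_cases h : ∃ d ∈ (F.bundle w n).Keff, (F.bundle w n).v d = 0 ∧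
        ∀ a, pair (F.bundleBasis n p a) d = e a
    · obtain ⟨d, hd, hv, he⟩ := h
      have hI := ICoeff_eq_prod hn hd he
      rw [hv] at hI
      have hlead := hasLead_prod_hyperFactor (fun i => (F.bundle w n).divisor 0 i)
        fun i => pair ((F.bundle w n).D i) d
      rw [← hI] at hlead
      have hnn := sum_ceil_nonneg hw hn hwn hrho hd
      set s := ∑ i, ⌈pair ((F.bundle w n).D i) d⌉ with hs
      set J := Finset.univ.filter fun i => IsNegInt (pair ((F.bundle w n).D i) d) with hJ
      have hmem (i) : i ∈ J ↔ IsNegInt (pair ((F.bundle w n).D i) d) := by simp [hJ]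
      rcases lt_or_ge 1 (s + J.card) with hdeg | hdeg
      · exact ⟨0, by rw [hlead.1 1 hdeg, map_zero]⟩
      · rcases Nat.eq_zero_or_pos J.card with hJ0 | hJ0
        · rw [Finset.card_eq_zero] at hJ0
          rcases hnn.eq_or_lt with hs0 | hs0
          · have hd0 : d = 0 := eq_zero_of_forall_not_isNegInt hw hn hwn hrho hd hs0.symm
              fun i hi => by simpa [hJ0] using (hmem i).2 hi
            subst hd0
            simp only [pair_zero, hyperFactor_zero, Finset.prod_const_one] at hI
            exact ⟨0, by rw [hI, map_zero, HahnSeries.coeff_one, if_neg one_ne_zero]⟩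
          -- No divisor class occurs in the leading coefficient, so it is a scalar in `H^0`.
          · have hs1 : s = 1 := by lia
            refine ⟨∏ i, leadScalar (pair ((F.bundle w n).D i) d), ?_⟩
            · have := hlead.2
              rw [hJ0, Finset.card_empty, hs1, Finset.prod_empty, mul_one, Nat.cast_zero,
                add_zero] at this
              exact this
        -- Now the ceiling sum is `0` and one divisor is negative, so `d` belongs to a `Λ_k`, which
        -- `hcorr` has excluded.
        · obtain ⟨j, hj⟩ := Finset.card_eq_one.1 (show J.card = 1 by lia)
          obtain ⟨k, d', hd', rfl⟩ := exists_mem_corrIndex hw hn hwn hrho hd (j := j)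
            (by lia) fun i => by rw [← hmem, hj, Finset.mem_singleton]
          exact absurd ⟨k, d', ⟨hd', (v_ofFibre_eq_zero_iff hn d').1 hv⟩, he⟩ hcorr
    · exact ⟨0, by rw [ICoeff_eq_zero fun d hd hv he => h ⟨d, hd, hv, he⟩, HahnSeries.coeff_zero,
        map_zero]⟩

theorem zero_mem_bundle_Box : (0 : (F.bundle w n).Nlat) ∈ (F.bundle w n).Box :=
  ⟨0, fun _ => ⟨le_rfl, zero_lt_one⟩, ⟨_, bundle_univ_mem_anticone, fun _ _ => rfl⟩, by simp⟩

/-- The section class is `(0, 1/n)`, on which `p_0 = (0, n)` has degree `1` and the lifted `p_a`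
have degree `0`. -/
theorem snd_sectionHom_sum_cls (hn : 0 < n) (g : Option (Fin r) → ℚ) :
    (F.sectionHom w hn (∑ a, g a • (F.bundle w n).cls 0
      (F.bundleBasis n p (a.map Sum.inl)))).snd = g none := by
  have hn' : (n : ℚ) ≠ 0 := by exact_mod_cast hn.ne'
  rw [map_sum, Fintype.sum_option]
  simp only [map_smul, sectionHom_cls]
  simp [bundleBasis, hn']

theorem isG0_iff (hw : ∀ i, 0 ≤ w i) (hn : 0 < n) (hwn : ∑ i, w i ≤ n) (hrho : F.IsNef F.rhoS)
    (hbox : ∀ k, ∃ I c, F.IsBoxVector k I c) (hp : F.IsNefBasis p)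
    (G : FracSeries (Option (Fin r ⊕ Fin l)) ℚ) :
    F.IsG0 w n p G ↔
      G = constInY0 (∑ k, (w k / n : ℚ) • F.corrSeries k (F.corrIndex₀ k) p) := by
  classical
  have hsum (e : Option (Fin r ⊕ Fin l) → ℚ) :
      constInY0 (∑ k, (w k / n : ℚ) • F.corrSeries k (F.corrIndex₀ k) p) e =
        ∑ k, (w k / n : ℚ) * constInY0 (F.corrSeries k (F.corrIndex₀ k) p) e := by
    simp only [constInY0]
    split_ifs <;> simp [Finset.sum_apply]
  constructor
  · rintro ⟨g, τ, hg, rfl⟩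
    funext e
    obtain ⟨-, -, h1, h2⟩ := hg e ⟨0, zero_mem_bundle_Box⟩
    obtain ⟨t, ht⟩ := h2 rfl
    obtain ⟨t', ht'⟩ := ICoeff_coeff_one (p := p) hw hn hwn hrho e
    rw [ht', if_pos rfl, ht] at h1
    -- The `ε`-part eliminates the `H^0` scalars and all `p_a` with `a ≠ 0`, leaving `g_0` on one
    -- side and the section degrees `-w_k / n` on the other.
    have h3 := congrArg (fun y => (F.sectionHom w hn y).snd) h1
    simp only [map_sub, map_add, TrivSqZeroExt.snd_add, TrivSqZeroExt.snd_sub] at h3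
    rw [snd_sectionHom_sum_cls hn fun a => g a e] at h3
    simp only [AlgHom.commutes, TrivSqZeroExt.algebraMap_eq_inl, TrivSqZeroExt.snd_inl, add_zero,
      zero_sub, map_sum, map_smul, sectionHom_divisor, sectionDegree_ray] at h3
    rw [← h3, hsum, TrivSqZeroExt.snd_sum, ← Finset.sum_neg_distrib]
    refine Finset.sum_congr rfl fun k _ => ?_
    simp
    ring
  · rintro rfl
    -- Expanding `-∑ (series of k) D̂_k` in the `p_a` gives the `g_a`; `τ` is the remainder, with no
    -- condition on it in the twisted sectors.
    let g (a : Option (Fin r)) : FracSeries (Option (Fin r ⊕ Fin l)) ℚ := fun e =>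
      -∑ k, constInY0 (F.corrSeries k (F.corrIndex₀ k) p) e * rayCoeff w n p k a
    refine ⟨g, fun e x => ((F.bundle w n).ICoeff (F.bundleBasis n p) e x.1).coeff 1 -
      if x.1 = 0 then ∑ a, g a e • (F.bundle w n).cls x.1 (F.bundleBasis n p (a.map Sum.inl))
      else 0, fun e x => ⟨fun k hk => ICoeff_coeff_of_neg hw hn hwn hrho e x.1 hk,
        by convert ICoeff_coeff_zero hw hn hwn hrho e x.1, by rw [add_sub_cancel], ?_⟩, ?_⟩
    · obtain ⟨x, hx⟩ := x
      rintro rfl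
      obtain ⟨t, ht⟩ := ICoeff_coeff_one (p := p) hw hn hwn hrho e
      refine ⟨t, ?_⟩
      beta_reduce
      rw [if_pos rfl, ht, sub_sub, sub_eq_self]
      simp only [divisor_ray_eq hn hbox hp, Finset.smul_sum, smul_smul]
      rw [Finset.sum_comm, ← Finset.sum_add_distrib]
      refine Finset.sum_eq_zero fun a _ => ?_
      rw [← Finset.sum_smul, ← add_smul]
      simp only [g, add_neg_cancel, zero_smul]
    · funext e
      simp only [g, hsum, ← Finset.sum_neg_distrib]
      refine Finset.sum_congr rfl fun k _ => ?_
      rw [rayCoeff]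
      ring

end Coefficients

/-! ### The weights for divisors and for box elements -/

section Weights

theorem lcd_pos (c : Fin m → ℚ) : 0 < lcd c :=
  Nat.pos_of_ne_zero fun h => by
    obtain ⟨i, -, hi⟩ := Finset.lcm_eq_zero_iff.1 h
    exact (c i).den_nz hi

/-- The denominator of `c i` divides `lcd c`, so the product is an integer and taking its numerator
loses nothing. -/
theorem cast_num_mul_lcd (c : Fin m → ℚ) (i : Fin m) :
    ((c i * (lcd c : ℚ)).num : ℚ) = c i * lcd c := by
  obtain ⟨a, ha⟩ : (c i).den ∣ lcd c := Finset.dvd_lcm (Finset.mem_univ i)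
  have h : c i * (lcd c : ℚ) = ((c i).num * a : ℤ) := by
    rw [ha]
    push_cast
    rw [← mul_assoc, Rat.mul_den_eq_num]
  rw [h, Rat.num_intCast]

theorem isDivisorG0_iff (hrho : F.IsNef F.rhoS)
    (hbox : ∀ k, ∃ I c, F.IsBoxVector k I c) (hp : F.IsNefBasis p) (j : Fin m)
    (G : FracSeries (Option (Fin r ⊕ Fin l)) ℚ) :
    F.IsDivisorG0 j p G ↔ G = constInY0 (F.corrSeries j (F.corrIndex₀ j) p) := by
  rw [IsDivisorG0, isG0_iff (fun i => ?_) one_pos (by simp) hrho hbox hp,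
    Finset.sum_eq_single (a := j)]
  · simp
  · intro k _ hk
    simp [hk]
  · simp
  · rw [Pi.single_apply]
    split_ifs <;> simp

-- The weights satisfy `w_k / n = c_k`, and age at most `1` is exactly `∑ w_k ≤ n`. Dropping the
-- indices with `k ∈ I` is harmless because `c_k = 0` there.
open Classical in
theorem isBoxG0_iff (hrho : F.IsNef F.rhoS)
    (hbox : ∀ k, ∃ I c, F.IsBoxVector k I c) (hp : F.IsNefBasis p) {j : Fin l}
    {I : Set (Fin m ⊕ Fin l)} {c : Fin m → ℚ} (hc : F.IsBoxVector j I c) (hage : ∑ i, c i ≤ 1)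
    (G : FracSeries (Option (Fin r ⊕ Fin l)) ℚ) :
    F.IsBoxG0 c p G ↔ G = constInY0 (∑ k ∈ Finset.univ.filter (fun k => Sum.inl k ∉ I),
      c k • F.corrSeries k (F.corrIndex₀ k) p) := by
  have hpos : (0 : ℚ) < lcd c := by exact_mod_cast lcd_pos c
  rw [IsBoxG0, isG0_iff (fun i => ?_) (by exact_mod_cast lcd_pos c) ?_ hrho hbox hp]
  · rw [Finset.sum_filter]
    have h (k : Fin m) : (((c k * (lcd c : ℚ)).num : ℚ) / ((lcd c : ℤ) : ℚ)) •
        F.corrSeries k (F.corrIndex₀ k) p =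
        if Sum.inl k ∉ I then c k • F.corrSeries k (F.corrIndex₀ k) p else 0 := by
      rw [cast_num_mul_lcd, Int.cast_natCast, mul_div_cancel_right₀ _ hpos.ne']
      split_ifs with hk
      · rw [hc.2.2.1 k hk, zero_smul]
      · rfl
    simp only [h]
  · have : ((∑ i, (c i * (lcd c : ℚ)).num : ℤ) : ℚ) ≤ ((lcd c : ℤ) : ℚ) := by
      push_cast
      simp only [cast_num_mul_lcd, ← Finset.sum_mul]
      exact mul_le_of_le_one_left hpos.le hage
    exact_mod_cast this
  · exact Rat.num_nonneg.2 (mul_nonneg (hc.2.1 _).1 hpos.le)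

/-- If `d = x / M` has integral pairings, then `M · v(d) = β^S(x) = 0`, and `M` can be cancelled
when there is no torsion. -/
theorem corrIndex₀_eq [IsAddTorsionFree N] (k : Fin m) : F.corrIndex₀ k = F.corrIndex k := by
  refine Set.Subset.antisymm (fun d hd => hd.1) fun d hd => ⟨hd, ?_⟩
  have hint := hd.1
  obtain ⟨M, x, hM, rfl⟩ := exists_eq_inv_tmul d
  have hM' : (M : ℚ) ≠ 0 := by positivity
  have h : M • F.red ((M : ℚ)⁻¹ ⊗ₜ[ℤ] x) = 0 := by
    rw [← F.sum_smul_vec_eq_zero x, red, Finset.smul_sum]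
    refine Finset.sum_congr rfl fun i _ => ?_
    obtain ⟨a, ha⟩ := hint i
    rw [ha, Int.ceil_intCast, ← natCast_zsmul, smul_smul]
    congr 1
    rw [pair_tmul] at ha
    have : (M * a : ℚ) = F.DS i x := by
      rw [← ha]
      field_simp
    exact_mod_cast this
  exact (nsmul_eq_zero_iff_right hM.ne').1 h

end Weights
end ExtStackyFan
end ToricSeidel

open Classical in
theorem mainTheorem6 {N : Type*} [AddCommGroup N] [Module.Finite ℤ N] {m l r : ℕ}
    (F : ToricSeidel.ExtStackyFan N m l)
    (hgen : F.Generates)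
    (I : Fin l → Set (Fin m ⊕ Fin l)) (c : Fin l → Fin m → ℚ)
    (hbox : ∀ j, F.IsBoxVector j (I j) (c j))
    (hage : ∀ j, ∑ i, c j i ≤ 1)
    (hrho : F.IsNef F.rhoS)
    (p : Module.Basis (Fin r ⊕ Fin l) ℤ (Module.Dual ℤ F.LS))
    (hp : F.IsNefBasis p) :
    (∀ (j : Fin m) (G : ToricSeidel.FracSeries (Option (Fin r ⊕ Fin l)) ℚ),
      F.IsDivisorG0 j p G ↔
        G = ToricSeidel.constInY0 (F.corrSeries j (F.corrIndex₀ j) p)) ∧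
    (∀ (j : Fin l) (G : ToricSeidel.FracSeries (Option (Fin r ⊕ Fin l)) ℚ),
      F.IsBoxG0 (c j) p G ↔
        G = ToricSeidel.constInY0 (∑ k ∈ Finset.univ.filter (fun k => Sum.inl k ∉ I j),
          c j k • F.corrSeries k (F.corrIndex₀ k) p)) ∧
    (IsAddTorsionFree N →
      (∀ (j : Fin m) (G : ToricSeidel.FracSeries (Option (Fin r ⊕ Fin l)) ℚ),
        F.IsDivisorG0 j p G ↔
          G = ToricSeidel.constInY0 (F.corrSeries j (F.corrIndex j) p)) ∧
      (∀ (j : Fin l) (G : ToricSeidel.FracSeries (Option (Fin r ⊕ Fin l)) ℚ),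
        F.IsBoxG0 (c j) p G ↔
          G = ToricSeidel.constInY0 (∑ k ∈ Finset.univ.filter (fun k => Sum.inl k ∉ I j),
            c j k • F.corrSeries k (F.corrIndex k) p))) := by
  have hbox' : ∀ k, ∃ I c, F.IsBoxVector k I c := fun k => ⟨I k, c k, hbox k⟩
  have hdiv := F.isDivisorG0_iff (p := p) hrho hbox' hp
  have hboxG (j : Fin l) := F.isBoxG0_iff (p := p) hrho hbox' hp (hbox j) (hage j)
  refine ⟨hdiv, hboxG, fun _ => ⟨fun j G => ?_, fun j G => ?_⟩⟩
  · rw [hdiv, F.corrIndex₀_eq]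
  · rw [hboxG]
    simp only [F.corrIndex₀_eq]
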